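/- Let $K\subset S^3$ be a tame knot, $\pi=\pi_1(S^3\setminus K)$, and let $\alpha:\pi\to\mathbb Z$ be the abelianization (a surjective homomorphism with kernel $[\pi,\pi]$). Let $B_3=\langle\sigma_1,\sigma_2\mid\sigma_1\sigma_2\sigma_1=\sigma_2\sigma_1\sigma_2\rangle$, with the projection $B_3\to S_3$, $\sigma_1\mapsto(1\,2)$, $\sigma_2\mapsto(2\,3)$, and the exponent sum $\varepsilon:B_3\to\mathbb Z$, $\sigma_1,\sigma_2\mapsto1$. A tricoloring of $K$ is a homomorphism $\pi\to S_3$ sending every meridian to a transposition; it is non-trivial if it is not constant on the meridians, and $K$ is tricolorable if it has a non-trivial tricoloring. A simple $B_3$-coloring is a homomorphism $\pi\to B_3$ sending every meridian to a half twist, i.e. to a conjugate of $\sigma_1$ or $\sigma_1^{-1}$; it lifts a tricoloring $c$ if its composition with $B_3\to S_3$ is $c$. For a group $G$ with a finite presentation $\langle x_1,\dots,x_s\mid r_1,\dots,r_m\rangle$ and a homomorphism $\alpha:G\to\mathbb Z$, the Alexander polynomial of $(G,\alpha)$ is the greatest common divisor of the $(s-1)\times(s-1)$ minors of the matrix of Fox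 derivatives $(\partial r_i/\partial x_j)$, evaluated in $\mathbb Z[t^{\pm1}]$ by $g\mapsto t^{\alpha(g)}$. The Alexander polynomial of $K$ is that of $(\pi,\alpha)$. For a unique factorization domain $R$ and $\rho:G\to GL_n(R)$, let $\Phi$ be the linear extension of $g\mapsto t^{\alpha(g)}\rho(g)$. The twisted Alexander polynomial of $(G,\alpha,\rho)$ is $Q_j/\det\Phi(x_j-1)$, where $j$ is such that $\det\Phi(x_j-1)\neq0$ and $Q_j$ is the greatest common divisor of the $n(s-1)\times n(s-1)$ minors of the block matrix $(\Phi(\partial r_i/\partial x_k))_{i,\;k\ne j}$. Both are defined up to units of the Laurent polynomial ring, and a twisted Alexander polynomial $\Delta'$ divides $\Delta$ if $\Delta=\Delta' q$ for some $q\in R[t^{\pm1}]$. **Theorem.** Suppose that $K$ is tricolorable and that at least one of the following holds: 1. $1-t+t^2$ does not divide the Alexander polynomial of $K$ in $\mathbb Z[t^{\pm1}]$; 2. there are a unique factorization domain $R$, an integer $n\ge0$ and a representation $\rho':B_3\to GL_n(R)$ such that, for every representation $\rho:\pi\to GL_n(R)$ with the same image as $\rho'$, the twisted Alexander polynomial of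 $(B_3,\varepsilon,\rho')$ does not divide that of $(\pi,\alpha,\rho)$. Then no non-trivial tricoloring of $K$ lifts to a simple $B_3$-coloring. -/

import Mathlib

universe u

noncomputable section

/-! ## Knots, knot groups and meridians -/

/-- The three-dimensional sphere, as the unit sphere of `ℝ⁴`. -/
abbrev ThreeSphere : Type := Metric.sphere (0 : EuclideanSpace ℝ (Fin 4)) 1

/-- `e` is a tubular neighbourhood of `K ⊆ S³`: an open embedding of the open solid torus
`S¹ × ℂ` (the plane `ℂ` being the open disc) that maps the core `S¹ × {0}` onto `K`. -/
structure IsKnotTube (K : Set ThreeSphere) (e : Circle × ℂ → ThreeSphere) : Prop where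
  isOpenEmbedding : Topology.IsOpenEmbedding e
  core : Set.range (fun z : Circle => e (z, 0)) = K

/-- A (tame) knot: a circle in `S³` that has a tubular neighbourhood. All smooth and all
piecewise linear knots are of this kind. -/
def IsTameKnot (K : Set ThreeSphere) : Prop :=
  ∃ e : Circle × ℂ → ThreeSphere, IsKnotTube K e

/-- The knot group: the fundamental group of the complement of `K`. -/
abbrev KnotGroup (K : Set ThreeSphere) (x₀ : ↥(Kᶜ)) : Type :=
  FundamentalGroup ↥(Kᶜ) x₀

/-- `g` is a meridian of `K`: it is represented by a loop that runs from the base point along a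
path `δ`, then once around the boundary `θ ↦ e (z, exp (i θ))` of a meridian disc of a tubular
neighbourhood `e` of `K`, and back along `δ`. Both directions around `K` are allowed, since `e`
need not preserve orientations. -/
def IsMeridian (K : Set ThreeSphere) (x₀ : ↥(Kᶜ)) (g : KnotGroup K x₀) : Prop :=
  ∃ (e : Circle × ℂ → ThreeSphere) (z : Circle) (p : ↥(Kᶜ)) (γ : Path p p) (δ : Path x₀ p),
    IsKnotTube K e ∧
    (∀ t : unitInterval,
      ((γ t : ↥(Kᶜ)) : ThreeSphere) =
        e (z, Complex.exp (2 * (Real.pi : ℂ) * Complex.I * ((t : ℝ) : ℂ)))) ∧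
    g = FundamentalGroup.fromPath
      (Path.Homotopic.Quotient.mk ((δ.trans γ).trans δ.symm))

/-! ## The braid group on three strands -/

/-- The braid relation `σ₁ σ₂ σ₁ = σ₂ σ₁ σ₂`. -/
def braidThreeRel : FreeGroup (Fin 2) :=
  FreeGroup.of 0 * FreeGroup.of 1 * FreeGroup.of 0 *
    (FreeGroup.of 1 * FreeGroup.of 0 * FreeGroup.of 1)⁻¹

/-- The braid group `B₃`, by Artin's presentation `⟨σ₁, σ₂ | σ₁ σ₂ σ₁ = σ₂ σ₁ σ₂⟩`;
the generators are indexed by `0` and `1`. -/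
abbrev BraidThree : Type := PresentedGroup ({braidThreeRel} : Set (FreeGroup (Fin 2)))

/-- The projection `B₃ → S₃`, `σ₁ ↦ (1 2)`, `σ₂ ↦ (2 3)`. -/
def BraidThree.toPerm : BraidThree →* Equiv.Perm (Fin 3) :=
  PresentedGroup.toGroup (f := ![Equiv.swap 0 1, Equiv.swap 1 2]) (by
    intro r hr
    rw [Set.mem_singleton_iff] at hr
    subst hr
    simp only [braidThreeRel, map_mul, map_inv, FreeGroup.lift_apply_of]
    decide)

/-- The exponent sum `B₃ → ℤ`, `σ₁, σ₂ ↦ 1`; this is the abelianization of `B₃`. -/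
def BraidThree.exponentSum : BraidThree →* Multiplicative ℤ :=
  PresentedGroup.toGroup (f := fun _ : Fin 2 => Multiplicative.ofAdd (1 : ℤ)) (by
    intro r hr
    rw [Set.mem_singleton_iff] at hr
    subst hr
    simp only [braidThreeRel, map_mul, map_inv, FreeGroup.lift_apply_of]
    decide)

/-- A (positive or negative) half twist: a conjugate of `σ₁` or of `σ₁⁻¹`. -/
def BraidThree.IsHalfTwist (b : BraidThree) : Prop :=
  IsConj (PresentedGroup.of 0) b ∨ IsConj (PresentedGroup.of 0)⁻¹ b

/-! ## Colorings -/

/-- A tricoloring: a homomorphism from the knot group to `S₃` that maps meridians to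
transpositions. -/
def IsTricoloring (K : Set ThreeSphere) (x₀ : ↥(Kᶜ))
    (c : KnotGroup K x₀ →* Equiv.Perm (Fin 3)) : Prop :=
  ∀ g, IsMeridian K x₀ g → (c g).IsSwap

/-- A tricoloring is non-trivial if it is not constant on the meridians. -/
def IsNontrivialTricoloring (K : Set ThreeSphere) (x₀ : ↥(Kᶜ))
    (c : KnotGroup K x₀ →* Equiv.Perm (Fin 3)) : Prop :=
  IsTricoloring K x₀ c ∧ ∃ g h, IsMeridian K x₀ g ∧ IsMeridian K x₀ h ∧ c g ≠ c h

/-- A knot is tricolorable if it has a non-trivial tricoloring. -/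
def IsTricolorable (K : Set ThreeSphere) (x₀ : ↥(Kᶜ)) : Prop :=
  ∃ c : KnotGroup K x₀ →* Equiv.Perm (Fin 3), IsNontrivialTricoloring K x₀ c

/-- A simple `B₃`-coloring: a homomorphism from the knot group to `B₃` that maps meridians to
half twists. -/
def IsSimpleBraidColoring (K : Set ThreeSphere) (x₀ : ↥(Kᶜ))
    (φ : KnotGroup K x₀ →* BraidThree) : Prop :=
  ∀ g, IsMeridian K x₀ g → (φ g).IsHalfTwist

/-- The `S₃`-coloring `c` lifts to a simple `B₃`-coloring. -/
def LiftsToSimpleBraidColoring (K : Set ThreeSphere) (x₀ : ↥(Kᶜ))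
    (c : KnotGroup K x₀ →* Equiv.Perm (Fin 3)) : Prop :=
  ∃ φ : KnotGroup K x₀ →* BraidThree,
    IsSimpleBraidColoring K x₀ φ ∧ BraidThree.toPerm.comp φ = c

/-! ## Fox calculus and Alexander polynomials -/

/-- The Fox derivative of a word with respect to the generator `j`; a letter `(i, true)` stands
for `xᵢ` and `(i, false)` for `xᵢ⁻¹`. -/
def foxWord {X : Type} [DecidableEq X] (j : X) :
    List (X × Bool) → MonoidAlgebra ℤ (FreeGroup X)
  | [] => 0
  | (i, true) :: w =>
      (if i = j then 1 else 0) +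
        MonoidAlgebra.of ℤ (FreeGroup X) (FreeGroup.of i) * foxWord j w
  | (i, false) :: w =>
      (if i = j then -MonoidAlgebra.of ℤ (FreeGroup X) (FreeGroup.of i)⁻¹ else 0) +
        MonoidAlgebra.of ℤ (FreeGroup X) (FreeGroup.of i)⁻¹ * foxWord j w

/-- The Fox derivative `∂w/∂xⱼ ∈ ℤ[F]` of an element `w` of the free group `F`. -/
def foxDerivative {X : Type} [DecidableEq X] (j : X) (w : FreeGroup X) :
    MonoidAlgebra ℤ (FreeGroup X) :=
  foxWord j w.toWord

/-- A finite presentation `⟨x₁, …, x_s | r₁, …, r_m⟩` of the group `G`. -/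
structure FiniteGroupPresentation (G : Type) [Group G] where
  /-- the number of generators -/
  s : ℕ
  /-- the number of relators -/
  m : ℕ
  /-- the relators -/
  rel : Fin m → FreeGroup (Fin s)
  /-- the identification of the presented group with `G` -/
  equiv : PresentedGroup (Set.range rel) ≃* G

/-- The projection from the free group on the generators to `G`. -/
def FiniteGroupPresentation.proj {G : Type} [Group G] (P : FiniteGroupPresentation G) :
    FreeGroup (Fin P.s) →* G :=
  P.equiv.toMonoidHom.comp (PresentedGroup.mk (Set.range P.rel))

/-- `α : G → ℤ` is the abelianization of `G` (up to the choice of a generator of `G/[G,G] ≅ ℤ`):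
it is onto with kernel `[G,G]`. -/
def IsInfiniteCyclicAbelianization {G : Type} [Group G] (α : G →* Multiplicative ℤ) : Prop :=
  Function.Surjective α ∧ α.ker = commutator G

/-- `d` is a greatest common divisor of the family `f`. -/
def IsGcdOfFamily {A ι : Type*} [CommRing A] (f : ι → A) (d : A) : Prop :=
  ∀ a : A, a ∣ d ↔ ∀ i, a ∣ f i

/-- The multiplicative map `g ↦ t ^ α(g)`. -/
def abelianWeight {G : Type} [Group G] (α : G →* Multiplicative ℤ) :
    G →* LaurentPolynomial ℤ where
  toFun g := LaurentPolynomial.T (Multiplicative.toAdd (α g))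
  map_one' := by simp
  map_mul' g h := by rw [map_mul, toAdd_mul, LaurentPolynomial.T_add]

/-- The Alexander matrix `(∂rᵢ/∂xⱼ)` over `ℤ[t, t⁻¹]`. -/
def alexanderMatrix {G : Type} [Group G] (α : G →* Multiplicative ℤ)
    (P : FiniteGroupPresentation G) : Matrix (Fin P.m) (Fin P.s) (LaurentPolynomial ℤ) :=
  Matrix.of fun i j =>
    MonoidAlgebra.lift ℤ (LaurentPolynomial ℤ) (FreeGroup (Fin P.s))
      ((abelianWeight α).comp P.proj) (foxDerivative j (P.rel i))

/-- `Δ` is an Alexander polynomial of `(G, α)`: for some finite presentation of `G` with `s`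
generators, it is a greatest common divisor of the minors of size `s - 1` of the Alexander matrix.
It is determined up to a unit of `ℤ[t, t⁻¹]`. -/
def IsAlexanderPolynomial {G : Type} [Group G] (α : G →* Multiplicative ℤ)
    (Δ : LaurentPolynomial ℤ) : Prop :=
  ∃ P : FiniteGroupPresentation G,
    IsGcdOfFamily
      (fun f : (Fin (P.s - 1) → Fin P.m) × (Fin (P.s - 1) → Fin P.s) =>
        ((alexanderMatrix α P).submatrix f.1 f.2).det) Δ

/-- The multiplicative map `g ↦ t ^ α(g) ρ(g)`. -/
def twistedWeight {G : Type} [Group G] {R : Type u} [CommRing R] {n : ℕ}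
    (α : G →* Multiplicative ℤ) (ρ : G →* Matrix.GeneralLinearGroup (Fin n) R) :
    G →* Matrix (Fin n) (Fin n) (LaurentPolynomial R) where
  toFun g := (LaurentPolynomial.T (Multiplicative.toAdd (α g)) : LaurentPolynomial R) •
    ((ρ g : Matrix (Fin n) (Fin n) R).map LaurentPolynomial.C)
  map_one' := by simp
  map_mul' g h := by
    rw [map_mul α, map_mul ρ, toAdd_mul, LaurentPolynomial.T_add, Units.val_mul, Matrix.map_mul,
      smul_mul_smul_comm]

/-- The linear extension of `w ↦ t ^ α(w) ρ(w)` to the group ring of the free group on the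
generators of a presentation. -/
def twistedEval {G : Type} [Group G] {R : Type u} [CommRing R] {n : ℕ}
    (α : G →* Multiplicative ℤ) (ρ : G →* Matrix.GeneralLinearGroup (Fin n) R)
    (P : FiniteGroupPresentation G) :
    MonoidAlgebra ℤ (FreeGroup (Fin P.s)) →ₐ[ℤ] Matrix (Fin n) (Fin n) (LaurentPolynomial R) :=
  MonoidAlgebra.lift ℤ (Matrix (Fin n) (Fin n) (LaurentPolynomial R)) (FreeGroup (Fin P.s))
    ((twistedWeight α ρ).comp P.proj)

/-- The twisted Alexander matrix, made of the `n × n` blocks that are the images of `∂rᵢ/∂xₖ`,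
without the columns that belong to the generator `xⱼ`. -/
def twistedAlexanderMatrix {G : Type} [Group G] {R : Type u} [CommRing R] {n : ℕ}
    (α : G →* Multiplicative ℤ) (ρ : G →* Matrix.GeneralLinearGroup (Fin n) R)
    (P : FiniteGroupPresentation G) (j : Fin P.s) :
    Matrix (Fin P.m × Fin n) ({k : Fin P.s // k ≠ j} × Fin n) (LaurentPolynomial R) :=
  Matrix.of fun a b => twistedEval α ρ P (foxDerivative b.1.1 (P.rel a.1)) a.2 b.2

/-- The determinant of the image of `xⱼ - 1`. -/
def twistedDenominator {G : Type} [Group G] {R : Type u} [CommRing R] {n : ℕ}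
    (α : G →* Multiplicative ℤ) (ρ : G →* Matrix.GeneralLinearGroup (Fin n) R)
    (P : FiniteGroupPresentation G) (j : Fin P.s) : LaurentPolynomial R :=
  (twistedEval α ρ P (MonoidAlgebra.of ℤ (FreeGroup (Fin P.s)) (FreeGroup.of j) - 1)).det

/-- `Δ` is a twisted Alexander polynomial (Wada invariant) of `(G, α, ρ)`: for some finite
presentation of `G` with `s` generators and some `j` such that the image of `xⱼ - 1` has a non-zero
determinant, it is the quotient by this determinant of a greatest common divisor of the minors of
size `n (s - 1)` of the twisted Alexander matrix without the columns of `xⱼ`. It lies in the ring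
of fractions of `R[t, t⁻¹]` and is determined up to a unit of `R[t, t⁻¹]`. -/
def IsTwistedAlexanderPolynomial {G : Type} [Group G] {R : Type u} [CommRing R] {n : ℕ}
    (α : G →* Multiplicative ℤ) (ρ : G →* Matrix.GeneralLinearGroup (Fin n) R)
    (Δ : FractionRing (LaurentPolynomial R)) : Prop :=
  ∃ (P : FiniteGroupPresentation G) (j : Fin P.s) (Q : LaurentPolynomial R),
    twistedDenominator α ρ P j ≠ 0 ∧
    IsGcdOfFamily
      (fun f : ({k : Fin P.s // k ≠ j} × Fin n) → (Fin P.m × Fin n) =>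
        ((twistedAlexanderMatrix α ρ P j).submatrix f id).det) Q ∧
    Δ * algebraMap (LaurentPolynomial R) (FractionRing (LaurentPolynomial R))
        (twistedDenominator α ρ P j) =
      algebraMap (LaurentPolynomial R) (FractionRing (LaurentPolynomial R)) Q

/-- `Δ'` divides `Δ`: the quotient of `Δ` by `Δ'` is a Laurent polynomial. -/
def TwistedDvd {R : Type u} [CommRing R] (Δ' Δ : FractionRing (LaurentPolynomial R)) : Prop :=
  ∃ q : LaurentPolynomial R,
    Δ = Δ' * algebraMap (LaurentPolynomial R) (FractionRing (LaurentPolynomial R)) q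

end

/-! ## The braid group on three strands as `⟨a, b | a² = b³⟩` -/

/-! Suppose that a non-trivial tricoloring lifts to `φ : π → B₃`. Two meridians with distinct
transpositions do not commute in `S₃`, so the image `H` of `φ` is not abelian. A meridian goes to a
half twist, so after a conjugation `H` contains `σ₁`. The abelianization of `π` is infinite cyclic
and `ε(σ₁) = 1`, hence the abelianization of `H` is generated by `σ₁`. The heart of the proof,
`BraidThree.eq_top_of_abelianization`, says that such an `H` is all of `B₃`.

For this, let `Z` be the centre and let `B₃/Z`, the free product of groups of orders 2 and 3
generated by `δ` and `γ`, act on `X = B₃/HZ`. View `X` as a graph: the orbits of `γ` are triangles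
or points, joined by edges `{x, δ x}`. A cocycle on `X` that vanishes on `σ₁` at the base point is a
coboundary (`exists_potential`, a form of Shapiro's lemma). If `γ` moves the base point, cocycles
modulo 3 and 2 show that `γ` has no fixed point and that every edge except the one at the base point
separates `X`. Unrolling that edge by an integral cocycle gives a covering which is a tree of
triangles, with stabilizers in `Z`. So every element of `H` is a power of `σ₁` up to `Z`, and `H` is
abelian, a contradiction. If `γ` fixes the base point, then `HZ = B₃`, and `H = B₃` follows.

Thus `φ` is onto and, up to `mirror`, carries `ε` to `α` (`exists_surjective_of_lifts`). Twisted
Alexander polynomials of a quotient divide those of the group (`twistedDvd_of_surjective`), which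
contradicts condition 2 for `ρ = ρ' ∘ φ`. For condition 1, at a primitive sixth root of unity the
affine Burau action of `B₃` on `ℂ` gives a second derivation of `π`, independent of the principal
one. So all the minors vanish there, and the cyclotomic polynomial `1 - t + t²` divides their gcd
(`IsAlexanderPolynomial.dvd_of_surjective`). -/

namespace BraidThree

/-- The Artin generators. -/
def sigma (i : Fin 2) : BraidThree := PresentedGroup.of i

/-- The half turn `σ₁ σ₂ σ₁`. -/
def delta : BraidThree := sigma 0 * sigma 1 * sigma 0

/-- The third turn `σ₁ σ₂`. -/
def gamma : BraidThree := sigma 0 * sigma 1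

/-- The full turn, which generates the centre. -/
def fullTwist : BraidThree := delta * delta

theorem braid_relation : sigma 0 * sigma 1 * sigma 0 = sigma 1 * sigma 0 * sigma 1 := by
  have h : PresentedGroup.mk ({braidThreeRel} : Set (FreeGroup (Fin 2))) braidThreeRel = 1 :=
    PresentedGroup.one_of_mem rfl
  exact mul_inv_eq_one.1 h

theorem gamma_cube : gamma * gamma * gamma = fullTwist := by
  have h := braid_relation
  unfold fullTwist delta gamma
  calc _ = sigma 0 * sigma 1 * sigma 0 * (sigma 1 * sigma 0 * sigma 1) := by group
    _ = _ := by rw [← h]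

theorem sigma_zero_eq : sigma 0 = gamma⁻¹ * delta := by
  unfold delta gamma; group

theorem sigma_one_eq : sigma 1 = delta⁻¹ * (gamma * gamma) := by
  have h := braid_relation
  rw [eq_inv_mul_iff_mul_eq]
  unfold delta gamma; group

theorem hom_ext {G : Type*} [Group G] {f g : BraidThree →* G}
    (h0 : f (sigma 0) = g (sigma 0)) (h1 : f (sigma 1) = g (sigma 1)) : f = g := by
  refine PresentedGroup.ext fun i => ?_
  fin_cases i
  · exact h0
  · exact h1

theorem eq_top_of_sigma_mem {H : Subgroup BraidThree} (h0 : sigma 0 ∈ H) (h1 : sigma 1 ∈ H) :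
    H = ⊤ := by
  rw [eq_top_iff, ← PresentedGroup.closure_range_of, Subgroup.closure_le]
  rintro _ ⟨i, rfl⟩
  fin_cases i
  · exact h0
  · exact h1

theorem eq_top_of_delta_mem {H : Subgroup BraidThree} (hd : delta ∈ H) (hg : gamma ∈ H) :
    H = ⊤ := by
  apply eq_top_of_sigma_mem
  · rw [sigma_zero_eq]; exact H.mul_mem (H.inv_mem hg) hd
  · rw [sigma_one_eq]; exact H.mul_mem (H.inv_mem hd) (H.mul_mem hg hg)

/-- The homomorphism from `B₃` given by the images of the Artin generators. -/
def ofSigma {G : Type*} [Group G] (s t : G) (h : s * t * s = t * s * t) : BraidThree →* G :=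
  PresentedGroup.toGroup (f := ![s, t]) (by
    intro r hr
    rw [Set.mem_singleton_iff] at hr
    subst hr
    simp only [braidThreeRel, map_mul, map_inv, FreeGroup.lift_apply_of]
    rw [mul_inv_eq_one]
    exact h)

@[simp] theorem ofSigma_zero {G : Type*} [Group G] (s t : G) (h : s * t * s = t * s * t) :
    ofSigma s t h (sigma 0) = s := by
  simp [ofSigma, sigma]

@[simp] theorem ofSigma_one {G : Type*} [Group G] (s t : G) (h : s * t * s = t * s * t) :
    ofSigma s t h (sigma 1) = t := by
  simp [ofSigma, sigma]

/-- The homomorphism from `B₃` given by elements `A`, `B` with `A² = B³`. -/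
def ofTurns {G : Type*} [Group G] (A B : G) (h : A * A = B * B * B) : BraidThree →* G :=
  ofSigma (B⁻¹ * A) (A⁻¹ * (B * B)) (by
    have h' : A⁻¹ * (B * B * B) = A := by rw [← h]; group
    calc _ = A := by group
      _ = A⁻¹ * (B * B * B) := h'.symm
      _ = _ := by group)

@[simp] theorem ofTurns_gamma {G : Type*} [Group G] (A B : G) (h : A * A = B * B * B) :
    ofTurns A B h gamma = B := by
  simp [ofTurns, gamma]

@[simp] theorem ofTurns_delta {G : Type*} [Group G] (A B : G) (h : A * A = B * B * B) :
    ofTurns A B h delta = A := by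
  simp [ofTurns, delta]

theorem fullTwist_comm (g : BraidThree) : fullTwist * g = g * fullTwist := by
  have hd : delta ∈ Subgroup.centralizer {fullTwist} := by
    rw [Subgroup.mem_centralizer_singleton_iff]; unfold fullTwist; group
  have hg : gamma ∈ Subgroup.centralizer {fullTwist} := by
    rw [Subgroup.mem_centralizer_singleton_iff, ← gamma_cube]; group
  have : g ∈ Subgroup.centralizer {fullTwist} := by
    rw [eq_top_of_delta_mem hd hg]; trivial
  exact (Subgroup.mem_centralizer_singleton_iff.1 this).symm

theorem zpowers_comm {c : BraidThree} (hc : c ∈ Subgroup.zpowers fullTwist) (g : BraidThree) :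
    c * g = g * c := by
  obtain ⟨k, rfl⟩ := hc
  exact (Commute.zpow_left (fullTwist_comm g : Commute _ _) k)

/-- The element spelled by a word in the turns, of which the first letter acts first. -/
def eval : List Bool → BraidThree
  | [] => 1
  | c :: l => eval l * (if c then delta else gamma)

theorem eval_append (l r : List Bool) : eval (l ++ r) = eval r * eval l := by
  induction l with
  | nil => simp [eval]
  | cons c l ih => simp [eval, ih, mul_assoc]

/-- Positive words suffice, since modulo the centre `δ⁻¹ = δ` and `γ⁻¹ = γ²`. -/
theorem exists_eval_mul (g : BraidThree) :
    ∃ l, ∃ c ∈ Subgroup.zpowers fullTwist, g = eval l * c := by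
  have key : Subgroup.closure {delta, gamma} = ⊤ :=
    eq_top_of_delta_mem (Subgroup.subset_closure (by simp)) (Subgroup.subset_closure (by simp))
  have hz : fullTwist ∈ Subgroup.zpowers fullTwist := Subgroup.mem_zpowers _
  have hg : g ∈ Subgroup.closure {delta, gamma} := by rw [key]; trivial
  induction hg using Subgroup.closure_induction_right with
  | one => exact ⟨[], 1, one_mem _, by simp [eval]⟩
  | mul_right x hx y hy ih =>
    obtain ⟨l, c, hc, rfl⟩ := ih
    rcases hy with rfl | rfl
    · exact ⟨true :: l, c, hc, by simp [eval, mul_assoc, zpowers_comm hc]⟩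
    · exact ⟨false :: l, c, hc, by simp [eval, mul_assoc, zpowers_comm hc]⟩
  | mul_inv_cancel x hx y hy ih =>
    obtain ⟨l, c, hc, rfl⟩ := ih
    rcases hy with rfl | rfl
    · refine ⟨true :: l, c * fullTwist⁻¹, mul_mem hc (inv_mem hz), ?_⟩
      simp only [eval, if_true]
      rw [← mul_assoc (eval l * delta), ← zpowers_comm hc (eval l * delta),
        ← zpowers_comm hc (eval l), fullTwist]
      group
    · refine ⟨false :: false :: l, c * fullTwist⁻¹, mul_mem hc (inv_mem hz), ?_⟩
      simp only [eval, Bool.false_eq_true, if_false]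
      rw [← mul_assoc (eval l * gamma * gamma), ← zpowers_comm hc (eval l * gamma * gamma),
        ← zpowers_comm hc (eval l), ← gamma_cube]
      group

/-! ### Actions whose graph is a tree of triangles: stabilizers are central. -/

section Tree

variable {Y : Type*} (F : BraidThree →* Equiv.Perm Y)

/-- `f` is the indicator function of one side of the edge from `y` to `a y`. -/
structure Separates (y : Y) (f : Y → Prop) : Prop where
  gamma_iff : ∀ x, f (F gamma x) ↔ f x
  delta_iff : ∀ x, x ≠ y → x ≠ F delta y → (f (F delta x) ↔ f x)
  not_iff : ¬ (f (F delta y) ↔ f y)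

/-- Only the edge `{y, δ y}` leads from one side to the other, so a path that starts on the side of
`δ y` and ends on the other must cross it, from `δ y`. -/
theorem Separates.exists_return {F : BraidThree →* Equiv.Perm Y} {y : Y} {f : Y → Prop}
    (hf : Separates F y f) (r : List Bool) :
    ∀ p, (f p ↔ f (F delta y)) → ¬ (f (F (eval r) p) ↔ f (F delta y)) →
      ∃ r₁ r₂, r = r₁ ++ true :: r₂ ∧ F (eval r₁) p = F delta y := by
  induction r with
  | nil => intro p h h'; exact absurd (by simpa [eval] using h) h'
  | cons c r ih =>
    intro p h h'
    cases c with
    | false =>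
      obtain ⟨r₁, r₂, rfl, h₁⟩ := ih (F gamma p) (by rw [hf.gamma_iff, h])
        (by simpa [eval] using h')
      exact ⟨false :: r₁, r₂, rfl, by simpa [eval] using h₁⟩
    | true =>
      by_cases h1 : p = F delta y
      · exact ⟨[], r, rfl, by simpa [eval] using h1⟩
      · have h2 : p ≠ y := by rintro rfl; exact hf.not_iff h.symm
        obtain ⟨r₁, r₂, rfl, h₁⟩ := ih (F delta p) (by rw [hf.delta_iff p h2 h1, h])
          (by simpa [eval] using h')
        exact ⟨true :: r₁, r₂, rfl, by simpa [eval] using h₁⟩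

-- A closed path that crosses a separating edge must cross it back, which cuts it into two shorter
-- closed paths. Induction on the length reduces to powers of `γ`.
variable {F} in
theorem eval_mem_of_fix (hz : F fullTwist = 1) (hb : ∀ y, F gamma y ≠ y)
    (sep : ∀ y, ∃ f, Separates F y f) :
    ∀ (n : ℕ) (l : List Bool), l.length = n → ∀ y, F (eval l) y = y →
      eval l ∈ Subgroup.zpowers fullTwist := by
  have hz' : fullTwist ∈ Subgroup.zpowers fullTwist := Subgroup.mem_zpowers _
  have hgam : ∀ y, F gamma (F gamma (F gamma y)) = y := fun y => by
    rw [← Equiv.Perm.mul_apply, ← Equiv.Perm.mul_apply, ← map_mul, ← map_mul,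
      gamma_cube, hz]; rfl
  have hdel : ∀ y, F delta (F delta y) = y := fun y => by
    rw [← Equiv.Perm.mul_apply, ← map_mul]
    change F fullTwist y = y
    rw [hz]; rfl
  intro n
  induction n using Nat.strong_induction_on with
  | _ n ih =>
  intro l hl y hy
  by_cases hm : true ∈ l
  · obtain ⟨s, t, rfl⟩ := List.append_of_mem hm
    -- The closed path is rotated so as to start with this letter `δ`; what remains is `t ++ s`,
    -- which has to return through the same edge.
    obtain ⟨f, hf⟩ := sep (F (eval s) y)
    have hr : F (eval (t ++ s)) (F delta (F (eval s) y)) = F (eval s) y := by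
      rw [eval_append] at hy ⊢
      simp only [eval, if_true, map_mul, Equiv.Perm.mul_apply] at hy ⊢
      rw [hy]
    obtain ⟨r₁, r₂, hrr, h₁⟩ := hf.exists_return (t ++ s) (F delta (F (eval s) y)) Iff.rfl
      (by rw [hr]; exact fun h => hf.not_iff h.symm)
    have hlen := congrArg List.length hrr
    simp only [List.length_append, List.length_cons] at hlen hl
    have m₁ := ih r₁.length (by omega) r₁ rfl _ h₁
    have m₂ := ih r₂.length (by omega) r₂ rfl (F (eval s) y) (by
      rw [hrr, eval_append] at hr
      simp only [eval, if_true, map_mul, Equiv.Perm.mul_apply] at hr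
      rwa [h₁, hdel] at hr)
    have e1 : eval s * eval t = eval r₂ * delta * eval r₁ := by
      have := congrArg eval hrr
      rwa [eval_append, eval_append] at this
    have e2 : eval s * eval t * delta ∈ Subgroup.zpowers fullTwist := by
      rw [e1, mul_assoc, zpowers_comm m₁, ← mul_assoc, mul_assoc (eval r₂)]
      exact mul_mem (mul_mem m₂ hz') m₁
    -- The rotated word is a conjugate of the original one, and it is central.
    have e3 : eval (s ++ true :: t) = eval s * eval t * delta := by
      have := zpowers_comm e2 (eval s)
      rw [mul_assoc, mul_assoc, mul_assoc] at this
      rw [eval_append]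
      simp only [eval, if_true]
      simpa [mul_assoc] using this
    rw [e3]; exact e2
  · have hev : ∀ l : List Bool, true ∉ l → eval l = gamma ^ l.length := by
      intro l
      induction l with
      | nil => intro; rfl
      | cons c l ih =>
        intro h
        cases c
        · simp at h
          simp [eval, ih h, pow_succ]
        · simp at h
    rw [hev l hm] at hy ⊢
    have h3 : ∀ k, gamma ^ (3 * k) = fullTwist ^ k := fun k => by
      rw [pow_mul, ← gamma_cube, pow_succ, pow_two]
    rw [← Nat.div_add_mod l.length 3, pow_add, h3] at hy ⊢
    have hlt := Nat.mod_lt l.length (show 3 > 0 by norm_num)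
    rw [map_mul, map_pow F fullTwist, hz, one_pow, one_mul] at hy
    have : l.length % 3 = 0 := by
      interval_cases h : l.length % 3
      · rfl
      · exact absurd (by simpa using hy) (hb y)
      · exfalso
        rw [pow_two, map_mul, Equiv.Perm.mul_apply] at hy
        apply hb y
        conv_lhs => rw [← hy]
        exact hgam y
    rw [this, pow_zero, mul_one]
    exact pow_mem hz' _

variable {F} in
theorem mem_zpowers_of_fix (hz : F fullTwist = 1) (hb : ∀ y, F gamma y ≠ y)
    (sep : ∀ y, ∃ f, Separates F y f) {g : BraidThree} {y : Y} (h : F g y = y) :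
    g ∈ Subgroup.zpowers fullTwist := by
  obtain ⟨l, c, hc, rfl⟩ := exists_eval_mul g
  have hFc : F c = 1 := by
    obtain ⟨k, rfl⟩ := hc
    simp [hz]
  refine mul_mem (eval_mem_of_fix hz hb sep _ l rfl y ?_) hc
  simpa [hFc] using h

end Tree

end BraidThree

namespace BraidThree

/-! ### Cocycles of the action and the coverings that they define. -/

section Skew

variable {X M : Type*} [AddCommGroup M]

/-- The permutation `(x, m) ↦ (e x, m + w x)`. -/
def skewPerm (e : Equiv.Perm X) (w : X → M) : Equiv.Perm (X × M) where
  toFun p := (e p.1, p.2 + w p.1)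
  invFun p := (e.symm p.1, p.2 - w (e.symm p.1))
  left_inv p := by simp
  right_inv p := by simp

@[simp] theorem skewPerm_apply (e : Equiv.Perm X) (w : X → M) (x : X) (m : M) :
    skewPerm e w (x, m) = (e x, m + w x) := rfl

variable (F : BraidThree →* Equiv.Perm X)

theorem delta_delta_apply {F : BraidThree →* Equiv.Perm X} (hz : F fullTwist = 1) (x : X) :
    F delta (F delta x) = x := by
  rw [← Equiv.Perm.mul_apply, ← map_mul]
  change F fullTwist x = x
  rw [hz]; rfl

theorem gamma_gamma_gamma_apply {F : BraidThree →* Equiv.Perm X} (hz : F fullTwist = 1) (x : X) :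
    F gamma (F gamma (F gamma x)) = x := by
  rw [← Equiv.Perm.mul_apply, ← Equiv.Perm.mul_apply, ← map_mul, ← map_mul, gamma_cube, hz]
  rfl

/-- A pair of functions `u`, `v` that extends to a cocycle of `B₃` modulo its centre. -/
structure IsCocycle (u v : X → M) : Prop where
  fullTwist : F fullTwist = 1
  delta : ∀ x, u x + u (F delta x) = 0
  gamma : ∀ x, v x + v (F gamma x) + v (F gamma (F gamma x)) = 0

variable {F} {u v : X → M}

theorem IsCocycle.delta_sq (h : IsCocycle F u v) :
    skewPerm (F BraidThree.delta) u * skewPerm (F BraidThree.delta) u = 1 := by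
  ext1 ⟨x, m⟩
  simp [delta_delta_apply h.fullTwist, add_assoc, h.delta]

theorem IsCocycle.gamma_cube (h : IsCocycle F u v) :
    skewPerm (F BraidThree.gamma) v * skewPerm (F BraidThree.gamma) v *
      skewPerm (F BraidThree.gamma) v = 1 := by
  ext1 ⟨x, m⟩
  have := h.gamma x
  rw [add_assoc] at this
  simp [gamma_gamma_gamma_apply h.fullTwist, add_assoc, this]

/-- The action of `B₃` on `X × M` that belongs to a cocycle. -/
def IsCocycle.action (h : IsCocycle F u v) : BraidThree →* Equiv.Perm (X × M) :=
  ofTurns (skewPerm (F BraidThree.delta) u) (skewPerm (F BraidThree.gamma) v)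
    (h.delta_sq.trans h.gamma_cube.symm)

theorem IsCocycle.action_delta (h : IsCocycle F u v) (x : X) (m : M) :
    h.action BraidThree.delta (x, m) = (F BraidThree.delta x, m + u x) := by
  simp [IsCocycle.action]

theorem IsCocycle.action_gamma (h : IsCocycle F u v) (x : X) (m : M) :
    h.action BraidThree.gamma (x, m) = (F BraidThree.gamma x, m + v x) := by
  simp [IsCocycle.action]

theorem IsCocycle.action_fullTwist (h : IsCocycle F u v) :
    h.action BraidThree.fullTwist = 1 := by
  rw [BraidThree.fullTwist, map_mul]
  simp [IsCocycle.action, h.delta_sq]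

/-- The action covers that on `X` and commutes with the translations of `M`; the constant `c` is the
value of the extended cocycle at `(g, x)`. -/
theorem IsCocycle.exists_action_eq (h : IsCocycle F u v) (g : BraidThree) (x : X) :
    ∃ c, ∀ m, h.action g (x, m) = (F g x, m + c) := by
  let S : Subgroup BraidThree :=
    { carrier := {g | ∀ x, ∃ c, ∀ m, h.action g (x, m) = (F g x, m + c)}
      one_mem' := fun x => ⟨0, fun m => by simp⟩
      mul_mem' := by
        intro g k hg hk x
        obtain ⟨c, hc⟩ := hk x
        obtain ⟨d, hd⟩ := hg (F k x)
        exact ⟨c + d, fun m => by simp [hc, hd, add_assoc]⟩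
      inv_mem' := by
        intro g hg x
        obtain ⟨c, hc⟩ := hg ((F g)⁻¹ x)
        refine ⟨-c, fun m => ?_⟩
        rw [map_inv, map_inv, Equiv.Perm.inv_eq_iff_eq, hc]
        simp }
  have : S = ⊤ := eq_top_of_delta_mem (fun x => ⟨_, fun m => h.action_delta x m⟩)
    (fun x => ⟨_, fun m => h.action_gamma x m⟩)
  have hg : g ∈ S := by rw [this]; trivial
  exact hg x

end Skew

/-- `H` is generated modulo its commutators by `σ₁`. -/
def AbelianizationGeneratedBySigma (H : Subgroup BraidThree) : Prop :=
  ∃ h : sigma 0 ∈ H, ∀ (M : Type) [CommGroup M] (ψ : H →* M), ψ ⟨sigma 0, h⟩ = 1 → ψ = 1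

/-- `x₀` is a point of a transitive action of `B₃` of which the stabilizer is `H` times the
centre. -/
structure IsBasePoint {X : Type} (F : BraidThree →* Equiv.Perm X) (H : Subgroup BraidThree)
    (x₀ : X) : Prop where
  exists_eq : ∀ x, ∃ g, F g x₀ = x
  fix : ∀ h ∈ H, F h x₀ = x₀
  exists_of_fix : ∀ g, F g x₀ = x₀ → ∃ h ∈ H, ∃ c ∈ Subgroup.zpowers fullTwist, g = h * c

/-! ### Cocycles are coboundaries, and the shape of the coset graph. -/

section Potential

variable {X : Type} {F : BraidThree →* Equiv.Perm X} {H : Subgroup BraidThree} {x₀ : X}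

theorem delta_eq_gamma_of_fix (h : F (sigma 0) x₀ = x₀) : F delta x₀ = F gamma x₀ := by
  rw [sigma_zero_eq, map_mul, map_inv, Equiv.Perm.mul_apply, Equiv.Perm.inv_eq_iff_eq] at h
  exact h

/-- Shapiro's lemma: restricted to `H` at `x₀`, the cocycle is a homomorphism to `M`. The condition
`u x₀ = v x₀` makes it vanish on `σ₁ = γ⁻¹ δ`, hence on `H`. Then integration along paths from `x₀`
is well defined. -/
theorem exists_potential (hx : IsBasePoint F H x₀) (hab : AbelianizationGeneratedBySigma H)
    {M : Type} [AddCommGroup M] {u v : X → M} (h : IsCocycle F u v) (huv : u x₀ = v x₀) :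
    ∃ f : X → M, ∀ x, f (F delta x) = f x + u x ∧ f (F gamma x) = f x + v x := by
  obtain ⟨h0, hab⟩ := hab
  choose c hc using h.exists_action_eq
  have c_mul : ∀ g k x, c (g * k) x = c k x + c g (F k x) := fun g k x => by
    have h1 := hc (g * k) x 0
    rw [map_mul, Equiv.Perm.mul_apply, hc, hc] at h1
    simpa using (congrArg Prod.snd h1).symm
  let ψ : H →* Multiplicative M :=
    { toFun := fun g => Multiplicative.ofAdd (c g x₀)
      map_one' := by
        have := c_mul 1 1 x₀
        simpa using this
      map_mul' := fun g k => by
        change Multiplicative.ofAdd (c (g * k : BraidThree) x₀) = _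
        rw [c_mul, hx.fix k k.2, add_comm, ofAdd_add] }
  have hψ : ψ = 1 := by
    apply hab
    change Multiplicative.ofAdd (c (sigma 0) x₀) = 1
    rw [ofAdd_eq_one]
    have h1 : h.action (sigma 0) (x₀, 0) = (x₀, 0) := by
      rw [sigma_zero_eq, map_mul, map_inv, Equiv.Perm.mul_apply, Equiv.Perm.inv_eq_iff_eq,
        h.action_delta, h.action_gamma, huv, delta_eq_gamma_of_fix (hx.fix _ h0)]
    rw [hc] at h1
    simpa using congrArg Prod.snd h1
  have cH : ∀ g ∈ H, c g x₀ = 0 := fun g hg => by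
    have := DFunLike.congr_fun hψ ⟨g, hg⟩
    exact this
  have cz : ∀ g ∈ Subgroup.zpowers fullTwist, ∀ x, c g x = 0 ∧ F g x = x := by
    rintro _ ⟨k, rfl⟩ x
    have := hc (fullTwist ^ k) x 0
    rw [map_zpow, h.action_fullTwist, one_zpow] at this
    refine ⟨by simpa using (congrArg Prod.snd this).symm, (congrArg Prod.fst this).symm⟩
  have cfix : ∀ g, F g x₀ = x₀ → c g x₀ = 0 := fun g hg => by
    obtain ⟨k, hk, d, hd, rfl⟩ := hx.exists_of_fix g hg
    rw [c_mul, (cz d hd _).1, (cz d hd _).2, cH k hk, add_zero]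
  choose s hs using hx.exists_eq
  -- Path independence: two elements with the same effect on `x₀` differ by one that fixes `x₀`,
  -- where the cocycle is zero.
  have key : ∀ g, c g x₀ = c (s (F g x₀)) x₀ := fun g => by
    have h1 : F ((s (F g x₀))⁻¹ * g) x₀ = x₀ := by
      rw [map_mul, map_inv, Equiv.Perm.mul_apply, Equiv.Perm.inv_eq_iff_eq, hs]
    have h2 := c_mul (s (F g x₀)) ((s (F g x₀))⁻¹ * g) x₀
    rwa [h1, cfix _ h1, mul_inv_cancel_left, zero_add] at h2
  have step : ∀ g x, c (s (F g x)) x₀ = c (s x) x₀ + c g x := fun g x => by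
    have h1 := c_mul g (s x) x₀
    rw [key, map_mul, Equiv.Perm.mul_apply, hs] at h1
    exact h1
  refine ⟨fun x => c (s x) x₀, fun x => ⟨?_, ?_⟩⟩
  · change c (s _) x₀ = _
    rw [step]
    have h1 := hc delta x 0
    rw [h.action_delta] at h1
    simpa using (congrArg Prod.snd h1).symm
  · change c (s _) x₀ = _
    rw [step]
    have h1 := hc gamma x 0
    rw [h.action_gamma] at h1
    simpa using (congrArg Prod.snd h1).symm

/-- At a fixed point `y` of `γ`, the value `1` is allowed modulo 3, as it is summed three times; a
potential would satisfy `f y = f y + 1`. -/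
theorem gamma_ne_of_basePoint (hx : IsBasePoint F H x₀)
    (hab : AbelianizationGeneratedBySigma H) (hz : F fullTwist = 1) (hne : F gamma x₀ ≠ x₀)
    (y : X) : F gamma y ≠ y := by
  classical
  intro hy
  have hy0 : y ≠ x₀ := by rintro rfl; exact hne hy
  have hiff : ∀ x, F gamma x = y ↔ x = y := fun x => by
    constructor
    · intro h; exact (F gamma).injective (h.trans hy.symm)
    · rintro rfl; exact hy
  have hcoc : IsCocycle F (0 : X → ZMod 3) (fun x => if x = y then 1 else 0) := by
    refine ⟨hz, fun x => by simp, fun x => ?_⟩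
    simp only [hiff]
    split_ifs <;> decide
  obtain ⟨f, hf⟩ := exists_potential hx hab hcoc (by simp [hy0.symm])
  have := (hf y).2
  rw [hy] at this
  simp at this

/-- The cocycle modulo 2 that counts crossings of the edge at `y` has a potential, whose two level
sets are the two sides of that edge. -/
theorem exists_separating (hx : IsBasePoint F H x₀)
    (hab : AbelianizationGeneratedBySigma H) (hz : F fullTwist = 1) (y : X) (hy : y ≠ x₀) (hy' : y ≠ F delta x₀) :
    ∃ f : X → Prop, Separates F y f ∧ ¬ f x₀ ∧ ¬ f (F delta x₀) := by
  classical
  have hdd := delta_delta_apply hz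
  have hiff : ∀ x, (F delta x = y ∨ F delta x = F delta y) ↔ (x = y ∨ x = F delta y) :=
    fun x => by
      rw [(F delta).injective.eq_iff, or_comm]
      refine or_congr_right ⟨fun h => by rw [← h, hdd], fun h => by rw [h, hdd]⟩
  have hcoc : IsCocycle F (fun x => if x = y ∨ x = F delta y then 1 else 0)
      (0 : X → ZMod 2) := by
    refine ⟨hz, fun x => ?_, fun x => by simp⟩
    simp only [hiff]
    split_ifs <;> decide
  have h0 : ¬ (x₀ = y ∨ x₀ = F delta y) := by
    rintro (h | h)
    · exact hy h.symm
    · exact hy' (by rw [h, hdd])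
  obtain ⟨f, hf⟩ := exists_potential hx hab hcoc (by simp [h0])
  refine ⟨fun x => f x ≠ f x₀, ⟨fun x => by simp [(hf x).2], fun x h1 h2 => ?_, ?_⟩, by simp, ?_⟩
  · simp [(hf x).1, h1, h2]
  · have := (hf y).1
    simp only [true_or, if_true] at this
    rw [this]
    generalize f y = p, f x₀ = q
    revert p q
    decide
  · simp [(hf x₀).1, h0]

/-- The covering `X × ℤ` unrolls the only edge that may fail to separate, the one at `x₀`. It is a
tree of triangles on which `σ₁` moves `(x₀, m)` up by one level, so a power of `σ₁` compensates the
shift by `h`. -/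
theorem exists_zpow_mul_mem_zpowers (hx : IsBasePoint F H x₀)
    (hab : AbelianizationGeneratedBySigma H) (hz : F fullTwist = 1) (hne : F gamma x₀ ≠ x₀)
    {h : BraidThree} (hh : h ∈ H) :
    ∃ k : ℤ, (sigma 0) ^ k * h ∈ Subgroup.zpowers fullTwist := by
  classical
  have hdd := delta_delta_apply hz
  have hdg : F delta x₀ = F gamma x₀ := delta_eq_gamma_of_fix (hx.fix _ hab.1)
  have hd0 : F delta x₀ ≠ x₀ := hdg ▸ hne
  have hcoc : IsCocycle F (fun x => if x = x₀ then 1 else if x = F delta x₀ then -1 else 0)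
      (0 : X → ℤ) := by
    refine ⟨hz, fun x => ?_, fun x => by simp⟩
    by_cases h1 : x = x₀
    · subst h1; simp [hd0]
    by_cases h2 : x = F delta x₀
    · subst h2; simp [hd0, hdd]
    have h3 : F delta x ≠ x₀ := fun h => h2 (by rw [← h, hdd])
    have h4 : F delta x ≠ F delta x₀ := fun h => h1 ((F delta).injective h)
    simp [h1, h2, h3, h4]
  have hsep : ∀ p : X × ℤ, ∃ f, Separates hcoc.action p f := by
    rintro ⟨y, n⟩
    by_cases h1 : y = x₀
    · subst h1
      -- Levels change only along the lifts of the edge at `x₀`; this lift is the only passage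
      -- between the levels `n` and `n + 1`.
      refine ⟨fun p => n < p.2, ⟨?_, ?_, ?_⟩⟩
      · rintro ⟨x, m⟩
        simp [hcoc.action_gamma]
      · rintro ⟨x, m⟩ h2 h3
        simp only [hcoc.action_delta, ne_eq, Prod.mk.injEq, not_and, if_true] at h2 h3 ⊢
        split_ifs with h4 h5
        · have := h2 h4; omega
        · have := h3 h5; omega
        · simp
      · simp [hcoc.action_delta]
    by_cases h1' : y = F delta x₀
    · subst h1'
      -- From `δ x₀` the same edge goes down, from level `n` to `n - 1`.
      refine ⟨fun p => n ≤ p.2, ⟨?_, ?_, ?_⟩⟩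
      · rintro ⟨x, m⟩
        simp [hcoc.action_gamma]
      · rintro ⟨x, m⟩ h2 h3
        simp only [hcoc.action_delta, ne_eq, Prod.mk.injEq, not_and, if_true, hdd, if_neg hd0]
          at h2 h3 ⊢
        split_ifs with h4 h5
        · have := h3 h4; omega
        · have := h2 h5; omega
        · simp
      · simp [hcoc.action_delta, hd0]
    obtain ⟨f, hf, hf0, hf1⟩ := exists_separating hx hab hz y h1 h1'
    -- The side away from the edge at `x₀` lifts to a single level, because `f` is false at both
    -- ends of that edge.
    refine ⟨fun p => p.2 = n ∧ f p.1, ⟨?_, ?_, ?_⟩⟩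
    · rintro ⟨x, m⟩
      simp [hcoc.action_gamma, hf.gamma_iff]
    · rintro ⟨x, m⟩ h2 h3
      simp only [hcoc.action_delta, ne_eq, Prod.mk.injEq, not_and, if_neg h1, if_neg h1', add_zero]
        at h2 h3 ⊢
      split_ifs with h4 h5
      · subst h4; simp [hf0, hf1]
      · subst h5; simp [hf0, hf1, hdd]
      · rw [add_zero]
        refine and_congr_right fun hm => hf.delta_iff x (fun h => h2 h hm) (fun h => h3 h hm)
    · simpa [hcoc.action_delta, h1, h1'] using hf.not_iff
  have hb : ∀ p, hcoc.action gamma p ≠ p := by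
    rintro ⟨x, m⟩ h
    rw [hcoc.action_gamma] at h
    exact gamma_ne_of_basePoint hx hab hz hne x (congrArg Prod.fst h)
  have hT : ∀ m, hcoc.action (sigma 0) (x₀, m) = (x₀, m + 1) := fun m => by
    rw [sigma_zero_eq, map_mul, map_inv, Equiv.Perm.mul_apply, Equiv.Perm.inv_eq_iff_eq,
      hcoc.action_delta, hcoc.action_gamma, hdg]
    simp
  have hTk : ∀ (k : ℤ) m, hcoc.action (sigma 0 ^ k) (x₀, m) = (x₀, m + k) := by
    intro k
    induction k using Int.induction_on with
    | zero => simp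
    | succ k ih =>
      intro m
      rw [zpow_add_one, map_mul, Equiv.Perm.mul_apply, hT, ih]
      congr 1; ring
    | pred k ih =>
      intro m
      rw [zpow_sub_one, map_mul, Equiv.Perm.mul_apply, map_inv]
      have : (hcoc.action (sigma 0))⁻¹ (x₀, m) = (x₀, m - 1) := by
        rw [Equiv.Perm.inv_eq_iff_eq, hT]; simp
      rw [this, ih]
      congr 1; ring
  obtain ⟨c, hc⟩ := hcoc.exists_action_eq h x₀
  refine ⟨-c, mem_zpowers_of_fix hcoc.action_fullTwist hb hsep (y := (x₀, 0)) ?_⟩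
  rw [map_mul, Equiv.Perm.mul_apply, hc, hx.fix h hh, hTk]
  simp

end Potential

theorem commute_of_zpow_mul_mem {g h : BraidThree} {k l : ℤ}
    (hg : sigma 0 ^ k * g ∈ Subgroup.zpowers fullTwist)
    (hh : sigma 0 ^ l * h ∈ Subgroup.zpowers fullTwist) : g * h = h * g := by
  have e1 : g = sigma 0 ^ (-k) * (sigma 0 ^ k * g) := by group
  have e2 : h = sigma 0 ^ (-l) * (sigma 0 ^ l * h) := by group
  have c0 : Commute (sigma 0 ^ (-k)) (sigma 0 ^ (-l)) :=
    (Commute.refl (sigma 0)).zpow_zpow _ _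
  rw [e1, e2]
  exact Commute.mul_left (c0.mul_right (zpowers_comm hh _ : Commute _ _).symm)
    (zpowers_comm hg _ : Commute _ _)

/-- A non-abelian subgroup of `B₃` whose abelianization is generated by `σ₁` is all of `B₃`. -/
theorem eq_top_of_abelianization {H : Subgroup BraidThree}
    (hab : AbelianizationGeneratedBySigma H) {x y : BraidThree} (hx : x ∈ H) (hy : y ∈ H)
    (hxy : x * y ≠ y * x) : H = ⊤ := by
  let Z : Subgroup BraidThree := Subgroup.zpowers fullTwist
  have hZn : Z.Normal := ⟨fun c hc g => by rw [← zpowers_comm hc]; simpa using hc⟩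
  let F : BraidThree →* Equiv.Perm (BraidThree ⧸ (H ⊔ Z)) := MulAction.toPermHom _ _
  have hF : ∀ g k : BraidThree, F g (QuotientGroup.mk k) = QuotientGroup.mk (g * k) :=
    fun _ _ => rfl
  have hz : F fullTwist = 1 := by
    ext1 p
    induction p using QuotientGroup.induction_on with
    | H k =>
      rw [hF, fullTwist_comm, Equiv.Perm.one_apply, QuotientGroup.eq]
      refine Subgroup.mem_sup_right ?_
      have e : (k * fullTwist)⁻¹ * k = fullTwist⁻¹ := by group
      rw [e]
      exact inv_mem (Subgroup.mem_zpowers fullTwist)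
  have hfix : ∀ g, F g (QuotientGroup.mk 1) = QuotientGroup.mk 1 ↔ g ∈ H ⊔ Z := fun g => by
    rw [hF, QuotientGroup.eq]
    simp
  have hbase : IsBasePoint F H (QuotientGroup.mk 1) := by
    refine ⟨fun p => ?_, fun h hh => (hfix h).2 (Subgroup.mem_sup_left hh), fun g hg => ?_⟩
    · induction p using QuotientGroup.induction_on with
      | H k => exact ⟨k, by rw [hF, mul_one]⟩
    · obtain ⟨h, hh, c, hc, e⟩ := Subgroup.mem_sup_of_normal_right.1 ((hfix g).1 hg)
      exact ⟨h, hh, c, hc, e.symm⟩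
  -- If `γ` fixes the base point, then `HZ` contains `γ` and `σ₁`, hence everything.
  by_cases hne : F gamma (QuotientGroup.mk 1) = QuotientGroup.mk 1
  · have hg : gamma ∈ H ⊔ Z := (hfix _).1 hne
    have htop : H ⊔ Z = ⊤ := by
      refine eq_top_of_delta_mem ?_ hg
      have e : gamma * sigma 0 = delta := by rw [sigma_zero_eq, mul_inv_cancel_left]
      exact e ▸ Subgroup.mul_mem _ hg (Subgroup.mem_sup_left hab.1)
    obtain ⟨h, hh, c, hc, e⟩ := Subgroup.mem_sup_of_normal_right.1
      (htop ▸ Subgroup.mem_top (sigma 0 * sigma 1) : sigma 0 * sigma 1 ∈ H ⊔ Z)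
    -- The conjugation of `σ₁` into `σ₂` is by `σ₁ σ₂ = h c` with `c` central, so it can be done by
    -- `h ∈ H`.
    have hconj : sigma 1 = sigma 0 * sigma 1 * sigma 0 * (sigma 0 * sigma 1)⁻¹ := by
      rw [braid_relation]; group
    refine eq_top_of_sigma_mem hab.1 ?_
    have : sigma 1 = h * sigma 0 * h⁻¹ := by
      rw [hconj, ← e, mul_assoc h c, zpowers_comm hc (sigma 0)]; group
    rw [this]
    exact mul_mem (mul_mem hh hab.1) (inv_mem hh)
  · exfalso
    obtain ⟨k, hk⟩ := exists_zpow_mul_mem_zpowers hbase hab hz hne hx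
    obtain ⟨l, hl⟩ := exists_zpow_mul_mem_zpowers hbase hab hz hne hy
    exact hxy (commute_of_zpow_mul_mem hk hl)

end BraidThree

/-! ### Surjectivity of the lifted coloring. -/

theorem IsInfiniteCyclicAbelianization.exists_zpow {G : Type} [Group G]
    {α : G →* Multiplicative ℤ} (hα : IsInfiniteCyclicAbelianization α) :
    ∃ t : G, ∀ (M : Type) [CommGroup M] (χ : G →* M) (g : G),
      χ g = χ t ^ (Multiplicative.toAdd (α g)) := by
  obtain ⟨t, ht⟩ := hα.1 (Multiplicative.ofAdd 1)
  refine ⟨t, fun M _ χ g => ?_⟩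
  have h1 : g * (t ^ (Multiplicative.toAdd (α g)))⁻¹ ∈ α.ker := by
    rw [MonoidHom.mem_ker, map_mul, map_inv, map_zpow, ht, mul_inv_eq_one, ← ofAdd_zsmul]
    simp
  rw [hα.2] at h1
  have h2 := Abelianization.commutator_subset_ker χ h1
  rw [MonoidHom.mem_ker, map_mul, map_inv, map_zpow, mul_inv_eq_one] at h2
  exact h2

theorem Equiv.Perm.eq_of_isSwap_of_mul_comm {p q : Equiv.Perm (Fin 3)} (hp : p.IsSwap)
    (hq : q.IsSwap) (h : p * q = q * p) : p = q := by
  obtain ⟨a, b, hab, rfl⟩ := hp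
  obtain ⟨c, d, hcd, rfl⟩ := hq
  revert a b c d
  decide

namespace BraidThree

@[simp] theorem exponentSum_sigma (i : Fin 2) :
    exponentSum (sigma i) = Multiplicative.ofAdd (1 : ℤ) := by
  simp [exponentSum, sigma]

/-- The automorphism `σ₁ ↦ σ₁⁻¹`, `σ₂ ↦ σ₂⁻¹`. -/
def mirror : BraidThree →* BraidThree :=
  ofSigma (sigma 0)⁻¹ (sigma 1)⁻¹ (by
    have h := congrArg (·⁻¹) braid_relation
    simpa [mul_assoc] using h)

theorem mirror_mirror (g : BraidThree) : mirror (mirror g) = g := by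
  have : mirror.comp mirror = MonoidHom.id BraidThree := hom_ext (by simp [mirror]) (by simp [mirror])
  exact DFunLike.congr_fun this g

theorem exponentSum_mirror (g : BraidThree) : exponentSum (mirror g) = (exponentSum g)⁻¹ := by
  have : exponentSum.comp mirror = exponentSum⁻¹ := hom_ext (by simp [mirror]) (by simp [mirror])
  exact DFunLike.congr_fun this g

variable {G : Type} [Group G] {α : G →* Multiplicative ℤ}

/-- Here `1 = ε(φ m) = ε(φ t) α(m)` in `ℤ`, so both factors are the same unit. -/
theorem exponentSum_generator {t : G}
    (ht : ∀ (M : Type) [CommGroup M] (χ : G →* M) (g : G),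
      χ g = χ t ^ (Multiplicative.toAdd (α g)))
    (φ : G →* BraidThree) {m : G} (hm : φ m = sigma 0) :
    (Multiplicative.toAdd (α m) = 1 ∧ exponentSum (φ t) = Multiplicative.ofAdd 1) ∨
    (Multiplicative.toAdd (α m) = -1 ∧ exponentSum (φ t) = Multiplicative.ofAdd (-1)) := by
  have h := ht _ (exponentSum.comp φ) m
  rw [MonoidHom.comp_apply, hm, exponentSum_sigma, MonoidHom.comp_apply] at h
  have h' := congrArg Multiplicative.toAdd h
  rw [toAdd_zpow, toAdd_ofAdd, smul_eq_mul] at h'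
  rcases Int.eq_one_or_neg_one_of_mul_eq_one' h'.symm with ⟨h1, h2⟩ | ⟨h1, h2⟩
  · exact Or.inl ⟨h1, h2⟩
  · exact Or.inr ⟨h1, h2⟩

/-- As `α(m) = ±1`, the element `m` generates the abelianization of `G`, so `σ₁ = φ m` generates
that of the image. -/
theorem surjective_of_sigma_mem_range (hα : IsInfiniteCyclicAbelianization α)
    (φ : G →* BraidThree) {m g : G} (hm : φ m = sigma 0) (hne : φ m * φ g ≠ φ g * φ m) :
    Function.Surjective φ := by
  obtain ⟨t, ht⟩ := hα.exists_zpow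
  rw [← MonoidHom.range_eq_top]
  refine eq_top_of_abelianization ⟨⟨m, hm⟩, fun M _ ψ hψ => ?_⟩ ⟨m, rfl⟩ ⟨g, rfl⟩ hne
  let χ : G →* M := ψ.comp φ.rangeRestrict
  have h0 : χ m = 1 := by
    rw [← hψ]
    exact congrArg ψ (Subtype.ext hm)
  have h1 : χ t = 1 := by
    have h2 := ht M χ m
    rcases exponentSum_generator ht φ hm with ⟨h3, -⟩ | ⟨h3, -⟩ <;> rw [h3, h0] at h2
    · simpa using h2.symm
    · simpa using h2.symm
  ext1 ⟨_, k, rfl⟩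
  have h2 := ht M χ k
  rw [h1, one_zpow] at h2
  exact h2

theorem surjective_of_isHalfTwist (hα : IsInfiniteCyclicAbelianization α)
    (φ : G →* BraidThree) {m g : G} (hm : (φ m).IsHalfTwist) (hne : φ m * φ g ≠ φ g * φ m) :
    Function.Surjective φ := by
  obtain ⟨k, m', hk, hne'⟩ : ∃ k m', k * sigma 0 * k⁻¹ = φ m' ∧ φ m' * φ g ≠ φ g * φ m' := by
    rcases hm with h | h
    · obtain ⟨k, hk⟩ := isConj_iff.1 h
      exact ⟨k, m, hk, hne⟩
    · obtain ⟨k, hk⟩ := isConj_iff.1 h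
      refine ⟨k, m⁻¹, ?_, fun h => hne ?_⟩
      · rw [map_inv, ← hk]; simp [sigma, mul_assoc]
      · rw [map_inv] at h
        exact ((Commute.inv_left_iff (a := φ m)).1 h)
  have hconj : ∀ x, (MulAut.conj k⁻¹).toMonoidHom.comp φ x = k⁻¹ * φ x * k := fun x => by simp
  have hs := surjective_of_sigma_mem_range hα ((MulAut.conj k⁻¹).toMonoidHom.comp φ) (m := m')
    (g := g) (by rw [hconj, ← hk]; group) (by
      rw [hconj, hconj]
      intro h
      apply hne'
      have e : ∀ x y : BraidThree, k * (k⁻¹ * x * k * (k⁻¹ * y * k)) * k⁻¹ = x * y :=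
        fun x y => by group
      rw [← e, h, e])
  intro b
  obtain ⟨x, hx⟩ := hs (k⁻¹ * b * k)
  rw [hconj] at hx
  exact ⟨x, by simpa using hx⟩

/-- Since `φ` is onto, `ε ∘ φ` is `α` or its inverse; in the second case `mirror` corrects the sign.
-/
theorem exists_surjective_of_isHalfTwist (hα : IsInfiniteCyclicAbelianization α)
    (φ : G →* BraidThree) {m g : G} (hm : (φ m).IsHalfTwist) (hne : φ m * φ g ≠ φ g * φ m) :
    ∃ φ' : G →* BraidThree, Function.Surjective φ' ∧ ∀ x, exponentSum (φ' x) = α x := by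
  have hs := surjective_of_isHalfTwist hα φ hm hne
  obtain ⟨t, ht⟩ := hα.exists_zpow
  obtain ⟨s, hs0⟩ := hs (sigma 0)
  have hx := fun x => ht _ (exponentSum.comp φ) x
  simp only [MonoidHom.comp_apply] at hx
  rcases exponentSum_generator ht φ hs0 with ⟨-, h1⟩ | ⟨-, h1⟩
  · refine ⟨φ, hs, fun x => ?_⟩
    rw [hx, h1, ← ofAdd_zsmul]; simp
  · refine ⟨mirror.comp φ, fun b => ?_, fun x => ?_⟩
    · obtain ⟨x, hx⟩ := hs (mirror b)
      exact ⟨x, by simp [hx, mirror_mirror]⟩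
    · rw [MonoidHom.comp_apply, exponentSum_mirror, hx, h1, ← ofAdd_zsmul]; simp

end BraidThree

theorem exists_surjective_of_lifts {K : Set ThreeSphere} {x₀ : ↥(Kᶜ)}
    {α : KnotGroup K x₀ →* Multiplicative ℤ} (hα : IsInfiniteCyclicAbelianization α)
    {c : KnotGroup K x₀ →* Equiv.Perm (Fin 3)} (hc : IsNontrivialTricoloring K x₀ c)
    (hl : LiftsToSimpleBraidColoring K x₀ c) :
    ∃ φ : KnotGroup K x₀ →* BraidThree, Function.Surjective φ ∧
      ∀ x, BraidThree.exponentSum (φ x) = α x := by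
  obtain ⟨φ, hφ, rfl⟩ := hl
  obtain ⟨htri, g, h, hg, hh, hne⟩ := hc
  refine BraidThree.exists_surjective_of_isHalfTwist hα φ (hφ g hg) (g := h) fun e => hne ?_
  refine Equiv.Perm.eq_of_isSwap_of_mul_comm (htri g hg) (htri h hh) ?_
  simp only [MonoidHom.comp_apply]
  rw [← map_mul, e, map_mul]

/-! ## Fox calculus -/

section Fox

theorem of_mul_of_inv {X : Type} (g : FreeGroup X) :
    MonoidAlgebra.of ℤ (FreeGroup X) g * MonoidAlgebra.of ℤ (FreeGroup X) g⁻¹ = 1 := by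
  rw [← map_mul, mul_inv_cancel, map_one]

theorem of_inv_mul_of {X : Type} (g : FreeGroup X) :
    MonoidAlgebra.of ℤ (FreeGroup X) g⁻¹ * MonoidAlgebra.of ℤ (FreeGroup X) g = 1 := by
  rw [← map_mul, inv_mul_cancel, map_one]

variable {X : Type} [DecidableEq X]

theorem foxWord_append (j : X) (L₁ L₂ : List (X × Bool)) :
    foxWord j (L₁ ++ L₂) =
      foxWord j L₁ + MonoidAlgebra.of ℤ (FreeGroup X) (FreeGroup.mk L₁) * foxWord j L₂ := by
  induction L₁ with
  | nil => simp [foxWord, ← FreeGroup.one_eq_mk, ← MonoidAlgebra.one_def]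
  | cons a L ih =>
    obtain ⟨i, b⟩ := a
    have hcons : FreeGroup.mk ((i, b) :: L) = FreeGroup.mk [(i, b)] * FreeGroup.mk L := by
      rw [FreeGroup.mul_mk]; rfl
    cases b with
    | true =>
      rw [List.cons_append, foxWord, foxWord, ih, hcons, map_mul]
      rw [show FreeGroup.mk [(i, true)] = FreeGroup.of i from rfl]
      simp only [mul_add, add_assoc, mul_assoc]
    | false =>
      rw [List.cons_append, foxWord, foxWord, ih, hcons, map_mul]
      rw [show FreeGroup.mk [(i, false)] = (FreeGroup.of i)⁻¹ from rfl]
      simp only [mul_add, add_assoc, mul_assoc]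

theorem foxWord_cancel (j i : X) (b : Bool) (L : List (X × Bool)) :
    foxWord j ((i, b) :: (i, !b) :: L) = foxWord j L := by
  cases b with
  | true =>
    simp only [Bool.not_true, foxWord, mul_add, ← mul_assoc, of_mul_of_inv, one_mul]
    split_ifs
    · rw [mul_neg, of_mul_of_inv]; abel
    · simp
  | false =>
    simp only [Bool.not_false, foxWord, mul_add, ← mul_assoc, of_inv_mul_of, one_mul]
    split_ifs
    · rw [mul_one]; abel
    · simp

/-- Invariance under cancellation lets the derivative be computed on unreduced words, which yields
the product rule. -/
theorem foxWord_eq_of_red (j : X) {L₁ L₂ : List (X × Bool)} (h : FreeGroup.Red L₁ L₂) :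
    foxWord j L₁ = foxWord j L₂ := by
  induction h with
  | refl => rfl
  | tail _ hs ih =>
    rw [ih]
    cases hs with
    | not => rw [foxWord_append, foxWord_append, foxWord_cancel]

theorem foxDerivative_mk (j : X) (L : List (X × Bool)) :
    foxDerivative j (FreeGroup.mk L) = foxWord j L := by
  rw [foxDerivative, FreeGroup.toWord_mk]
  exact (foxWord_eq_of_red j FreeGroup.reduce.red).symm

theorem foxDerivative_mul (j : X) (v w : FreeGroup X) :
    foxDerivative j (v * w) =
      foxDerivative j v + MonoidAlgebra.of ℤ (FreeGroup X) v * foxDerivative j w := by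
  conv_lhs => rw [← FreeGroup.mk_toWord (x := v), ← FreeGroup.mk_toWord (x := w),
    FreeGroup.mul_mk, foxDerivative_mk, foxWord_append, FreeGroup.mk_toWord]
  rfl

theorem foxDerivative_of (j i : X) :
    foxDerivative j (FreeGroup.of i) = if i = j then 1 else 0 := by
  rw [show FreeGroup.of i = FreeGroup.mk [(i, true)] from rfl, foxDerivative_mk]
  simp [foxWord]

variable {S : Type*} [Ring S]

/-- The image of the Fox derivative of `w` under the linear extension of `Φ`. -/
noncomputable def foxEval (Φ : FreeGroup X →* S) (j : X) (w : FreeGroup X) : S :=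
  MonoidAlgebra.lift ℤ S (FreeGroup X) Φ (foxDerivative j w)

theorem foxEval_mul (Φ : FreeGroup X →* S) (j : X) (v w : FreeGroup X) :
    foxEval Φ j (v * w) = foxEval Φ j v + Φ v * foxEval Φ j w := by
  simp [foxEval, foxDerivative_mul]

theorem foxEval_of (Φ : FreeGroup X →* S) (j i : X) :
    foxEval Φ j (FreeGroup.of i) = if i = j then 1 else 0 := by
  rw [foxEval, foxDerivative_of]
  split_ifs <;> simp

/-- A derivation of the free group is determined by its values on the generators. -/
theorem derivation_eq_sum [Fintype X] {M : Type*} [AddCommGroup M] [Module S M]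
    (Φ : FreeGroup X →* S) (D : FreeGroup X → M) (hD : ∀ v w, D (v * w) = D v + Φ v • D w)
    (w : FreeGroup X) : D w = ∑ k, foxEval Φ k w • D (FreeGroup.of k) := by
  have h1 : ∀ (D : FreeGroup X → M) (_ : ∀ v w, D (v * w) = D v + Φ v • D w), D 1 = 0 :=
    fun D hD => by simpa using hD 1 1
  have hinv : ∀ (D : FreeGroup X → M) (_ : ∀ v w, D (v * w) = D v + Φ v • D w) (v : _),
      D v⁻¹ = - (Φ v⁻¹ • D v) := fun D hD v => by
    have := hD v⁻¹ v
    rw [inv_mul_cancel, h1 D hD] at this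
    exact eq_neg_of_add_eq_zero_left this.symm
  let E : FreeGroup X → M := fun w => ∑ k, foxEval Φ k w • D (FreeGroup.of k)
  have hE : ∀ v w, E (v * w) = E v + Φ v • E w := fun v w => by
    simp only [E, foxEval_mul, add_smul, Finset.sum_add_distrib, Finset.smul_sum, mul_smul]
  change D w = E w
  induction w using FreeGroup.induction_on with
  | C1 => rw [h1 D hD, h1 E hE]
  | of i => simp [E, foxEval_of]
  | inv_of i ih => rw [hinv D hD, hinv E hE, ih]
  | mul v w hv hw => rw [hD, hE, hv, hw]

/-- The Fox derivatives of a consequence of the relators are combinations of the Fox derivatives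
of the relators. -/
theorem exists_foxEval_eq_sum {ι : Type*} [Fintype ι] [DecidableEq ι] (rel : ι → FreeGroup X)
    (Φ : FreeGroup X →* S) (hΦ : ∀ i, Φ (rel i) = 1) {w : FreeGroup X}
    (hw : w ∈ Subgroup.normalClosure (Set.range rel)) :
    ∃ c : ι → S, ∀ j, foxEval Φ j w = ∑ i, c i * foxEval Φ j (rel i) := by
  have hker : Subgroup.normalClosure (Set.range rel) ≤ Φ.ker := by
    refine Subgroup.normalClosure_le_normal ?_
    rintro _ ⟨i, rfl⟩
    exact hΦ i
  have hone : ∀ j, foxEval Φ j 1 = 0 := fun j => by simpa using foxEval_mul Φ j 1 1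
  have hinv : ∀ j v, foxEval Φ j v⁻¹ = - (Φ v⁻¹ * foxEval Φ j v) := fun j v => by
    have := foxEval_mul Φ j v⁻¹ v
    rw [inv_mul_cancel, hone] at this
    exact eq_neg_of_add_eq_zero_left this.symm
  induction hw using Subgroup.closure_induction with
  | mem x hx =>
    obtain ⟨r, ⟨i, rfl⟩, hr⟩ := Group.mem_conjugatesOfSet_iff.1 hx
    obtain ⟨g, rfl⟩ := isConj_iff.1 hr
    -- For `g r g⁻¹` with `Φ r = 1`, the derivatives of `g` and `g⁻¹` cancel and `Φ g` times that of
    -- `r` remains.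
    refine ⟨fun k => if k = i then Φ g else 0, fun j => ?_⟩
    simp only [foxEval_mul, hinv, map_mul, hΦ, mul_one, mul_neg, ← mul_assoc]
    rw [← map_mul, mul_inv_cancel, map_one, one_mul]
    simp
  | one => exact ⟨0, fun j => by simp [hone]⟩
  | mul x y hx hy ihx ihy =>
    obtain ⟨c, hc⟩ := ihx
    obtain ⟨d, hd⟩ := ihy
    refine ⟨fun i => c i + d i, fun j => ?_⟩
    have : Φ x = 1 := hker hx
    rw [foxEval_mul, this, one_mul, hc, hd, ← Finset.sum_add_distrib]
    simp only [add_mul]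
  | inv x hx ihx =>
    obtain ⟨c, hc⟩ := ihx
    refine ⟨fun i => - c i, fun j => ?_⟩
    have : Φ x⁻¹ = 1 := hker (inv_mem hx)
    rw [hinv, this, one_mul, hc]
    simp

end Fox

namespace FiniteGroupPresentation

variable {G : Type} [Group G] (P : FiniteGroupPresentation G)

theorem proj_surjective : Function.Surjective P.proj :=
  P.equiv.surjective.comp (QuotientGroup.mk'_surjective _)

theorem proj_rel (i : Fin P.m) : P.proj (P.rel i) = 1 := by
  have : PresentedGroup.mk (Set.range P.rel) (P.rel i) = 1 :=
    PresentedGroup.one_of_mem ⟨i, rfl⟩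
  simp [proj, this]

theorem mem_normalClosure {w : FreeGroup (Fin P.s)} (h : P.proj w = 1) :
    w ∈ Subgroup.normalClosure (Set.range P.rel) := by
  have : PresentedGroup.mk (Set.range P.rel) w = 1 := by
    simpa [proj] using h
  exact PresentedGroup.mk_eq_one_iff.1 this

end FiniteGroupPresentation

/-! ## Divisibility of minors -/

namespace Matrix

variable {Λ : Type*} [CommRing Λ]

/-- A weak Cauchy–Binet formula: by multilinearity in the rows, `det (Z * A)` is a combination of
maximal minors of `A`. -/
theorem dvd_det_mul_of_forall_dvd {γ ρ : Type*} [Fintype γ] [DecidableEq γ] [Fintype ρ]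
    [DecidableEq ρ] (Z : Matrix ρ γ Λ) (A : Matrix γ ρ Λ) {a : Λ}
    (h : ∀ f : ρ → γ, a ∣ (A.submatrix f id).det) : a ∣ (Z * A).det := by
  have h1 : (Z * A).det = detRowAlternating.toMultilinearMap fun k => ∑ i, Z k i • A i := by
    have hrow : Z * A = of fun k => ∑ i, Z k i • A i := by
      ext k c
      simp [mul_apply, Finset.sum_apply]
    rw [hrow]
    rfl
  rw [h1, MultilinearMap.map_sum]
  refine Finset.dvd_sum fun f _ => ?_
  rw [MultilinearMap.map_smul_univ]
  exact Dvd.dvd.mul_left (h f) _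

/-- A maximal minor of `diag(1, A)` is zero unless each row of the identity block is chosen exactly
once; then it is a maximal minor of `A` up to sign. -/
theorem dvd_det_submatrix_fromBlocks_one {l κ ι : Type*} [Fintype l] [DecidableEq l] [Fintype κ]
    [DecidableEq κ] (A : Matrix ι κ Λ) {a : Λ} (h : ∀ f : κ → ι, a ∣ (A.submatrix f id).det)
    (f : l ⊕ κ → l ⊕ ι) :
    a ∣ ((fromBlocks 1 0 0 A : Matrix (l ⊕ ι) (l ⊕ κ) Λ).submatrix f id).det := by
  by_cases hf : ∀ i, ∃ r, f r = Sum.inl i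
  · choose g hg using hf
    have ginj : Function.Injective g := fun i j hij => by
      have := congrArg f hij
      rw [hg, hg] at this
      exact Sum.inl_injective this
    let e : Equiv.Perm (l ⊕ κ) :=
      ((Equiv.ofInjective (Sum.inl : l → l ⊕ κ) Sum.inl_injective).symm.trans
        (Equiv.ofInjective g ginj)).extendSubtype
    have he : ∀ i, e (Sum.inl i) = g i := fun i => by
      have := Equiv.extendSubtype_apply_of_mem
        ((Equiv.ofInjective (Sum.inl : l → l ⊕ κ) Sum.inl_injective).symm.trans
        (Equiv.ofInjective g ginj)) (Sum.inl i) ⟨i, rfl⟩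
      rw [show e (Sum.inl i) = _ from this]
      simp [Equiv.ofInjective_symm_apply]
    rw [← IsUnit.dvd_mul_left (Units.isUnit (Units.map (Int.castRingHom Λ).toMonoidHom
      (Equiv.Perm.sign e)))]
    change a ∣ ((Equiv.Perm.sign e : ℤ) : Λ) * _
    rw [← det_permute]
    have hM : ((fromBlocks 1 0 0 A : Matrix (l ⊕ ι) (l ⊕ κ) Λ).submatrix f id).submatrix e id =
        fromBlocks 1 0
          (of fun k c => (fromBlocks 1 0 0 A : Matrix (l ⊕ ι) (l ⊕ κ) Λ) (f (e (Sum.inr k)))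
            (Sum.inl c))
          (of fun k c => (fromBlocks 1 0 0 A : Matrix (l ⊕ ι) (l ⊕ κ) Λ) (f (e (Sum.inr k)))
            (Sum.inr c)) := by
      ext (r | r) (c | c) <;> simp [he, hg]
    rw [hM, det_fromBlocks_zero₁₂, det_one, one_mul]
    by_cases hk : ∃ k i, f (e (Sum.inr k)) = Sum.inl i
    · obtain ⟨k, i, hki⟩ := hk
      rw [det_eq_zero_of_row_eq_zero k fun c => by simp [hki]]
      exact dvd_zero a
    · have : ∀ k, ∃ i, f (e (Sum.inr k)) = Sum.inr i := fun k => by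
        rcases hfe : f (e (Sum.inr k)) with i | i
        · exact absurd ⟨k, i, hfe⟩ hk
        · exact ⟨i, rfl⟩
      choose r hr using this
      convert h r using 2
      ext k c
      simp [hr]
  · push Not at hf
    obtain ⟨i, hi⟩ := hf
    rw [det_eq_zero_of_column_eq_zero (Sum.inl i) fun r => ?_]
    · exact dvd_zero a
    · rcases hfr : f r with j | j
      · have : j ≠ i := by rintro rfl; exact hi r hfr
        simp [hfr, this]
      · simp [hfr]

theorem mul_fromRows_zero_one {m ν κ : Type*} [Fintype ν] [Fintype κ] [DecidableEq κ]
    (B : Matrix m (ν ⊕ κ) Λ) :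
    B * (fromRows 0 1 : Matrix (ν ⊕ κ) κ Λ) = B.submatrix id Sum.inr := by
  ext r c
  simp [mul_apply, one_apply]

theorem add_mul_eq_fromCols_mul {m ν κ ι : Type*} [Fintype ν] [Fintype κ]
    [DecidableEq κ] [Fintype ι] {A : Matrix ι (ν ⊕ κ) Λ} {w : Matrix ν (ν ⊕ κ) Λ}
    {E : Matrix (ν ⊕ κ) (ν ⊕ κ) Λ} {A₀ : Matrix ι κ Λ} {w₀ : Matrix ν κ Λ} {Ω : Matrix ν ν Λ}
    (hA : A * E = fromCols 0 A₀) (hw : w * E = fromCols Ω w₀)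
    (B₁ : Matrix m ι Λ) (B₂ : Matrix m ν Λ) :
    (B₁ * A + B₂ * w) * E =
      fromCols B₂ (B₁ * A₀) * (fromBlocks Ω w₀ 0 1 : Matrix (ν ⊕ κ) (ν ⊕ κ) Λ) := by
  rw [Matrix.add_mul, Matrix.mul_assoc, Matrix.mul_assoc, hA, hw, mul_fromCols, mul_fromCols,
    fromCols_mul_fromBlocks]
  ext r (c | c) <;> simp [add_comm]

/-- Comparison of the maximal minors of two presentation matrices, when the module presented by
the first (generated by `p` elements, of which `N` are some relations) maps onto the module
presented by the second, which has the relations `A` and `w`. -/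
theorem mul_det_dvd_det_mul {p ν κ ι : Type*} [Fintype p] [DecidableEq p] [Fintype ν]
    [DecidableEq ν] [Fintype κ] [DecidableEq κ] [Fintype ι] [DecidableEq ι]
    {N : Matrix p p Λ} {V : Matrix p (ν ⊕ κ) Λ} {T : Matrix (ν ⊕ κ) p Λ}
    {A : Matrix ι (ν ⊕ κ) Λ} {w : Matrix ν (ν ⊕ κ) Λ}
    {X₁ : Matrix (ν ⊕ κ) ι Λ} {X₂ : Matrix (ν ⊕ κ) ν Λ} {Y₁ : Matrix p ι Λ} {Y₂ : Matrix p ν Λ}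
    {D : Matrix (ν ⊕ κ) ν Λ} (hI : T * V + X₁ * A + X₂ * w = 1) (hN : N * V = Y₁ * A + Y₂ * w)
    (hD : A * D = 0) {a : Λ} (ha : ∀ f : κ → ι, a ∣ (A.submatrix f Sum.inr).det) :
    a * (w * D).det ∣ N.det * (D.submatrix Sum.inl id).det := by
  let A₀ : Matrix ι κ Λ := A.submatrix id Sum.inr
  let w₀ : Matrix ν κ Λ := w.submatrix id Sum.inr
  -- This change of columns uses `A * D = 0` to clear the first block of `A`; its determinant
  -- accounts for the denominator of the second presentation.
  let E : Matrix (ν ⊕ κ) (ν ⊕ κ) Λ := fromCols D (fromRows 0 1)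
  let S : Matrix (ν ⊕ κ) (ν ⊕ κ) Λ := fromBlocks (w * D) w₀ 0 1
  have hE : E.det = (D.submatrix Sum.inl id).det := by
    have : E = fromBlocks (D.submatrix Sum.inl id) 0 (D.submatrix Sum.inr id) 1 := by
      ext (r | r) (c | c) <;> simp [E]
    rw [this, det_fromBlocks_zero₁₂, det_one, mul_one]
  have hS : S.det = (w * D).det := by
    rw [det_fromBlocks_zero₂₁, det_one, mul_one]
  have hAE : A * E = fromCols 0 A₀ := by
    rw [mul_fromCols, hD, mul_fromRows_zero_one]
  have hwE : w * E = fromCols (w * D) w₀ := by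
    rw [mul_fromCols, mul_fromRows_zero_one]
  have c₁ : (-Y₁ * A + -Y₂ * w) * E = fromCols (-Y₂) (-Y₁ * A₀) * S :=
    add_mul_eq_fromCols_mul hAE hwE _ _
  have c₂ : (X₁ * A + X₂ * w) * E = fromCols X₂ (X₁ * A₀) * S :=
    add_mul_eq_fromCols_mul hAE hwE _ _
  -- Taking determinants gives `det N * det E = det M * det (w * D)`, where `M` is the first factor
  -- on the right. It remains to show `a ∣ det M`.
  have hfac : (fromBlocks N 0 T 1 : Matrix (p ⊕ (ν ⊕ κ)) (p ⊕ (ν ⊕ κ)) Λ) *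
      fromBlocks 1 (-(V * E)) 0 E =
      fromBlocks N (fromCols (-Y₂) (-Y₁ * A₀)) T (fromCols X₂ (X₁ * A₀)) *
        fromBlocks 1 0 0 S := by
    rw [fromBlocks_multiply, fromBlocks_multiply,  ← c₁, ← c₂]
    congr 1
    · simp
    · rw [Matrix.mul_neg, ← Matrix.mul_assoc, hN, Matrix.zero_mul, Matrix.mul_zero, add_zero,
        zero_add, ← Matrix.neg_mul, neg_add, Matrix.neg_mul, Matrix.neg_mul]
    · simp
    · rw [Matrix.mul_neg, ← Matrix.mul_assoc]
      have : X₁ * A + X₂ * w = 1 - T * V := by rw [← hI]; abel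
      rw [this]
      rw [Matrix.sub_mul, Matrix.mul_zero, zero_add, sub_eq_add_neg, add_comm]
  have hdet := congrArg det hfac
  rw [det_mul, det_mul, det_fromBlocks_zero₁₂, det_fromBlocks_zero₂₁, det_fromBlocks_zero₂₁,
    det_one, det_one, mul_one, one_mul, one_mul, hE, hS] at hdet
  rw [hdet]
  refine mul_dvd_mul_right ?_ _
  rw [← det_submatrix_equiv_self (Equiv.sumAssoc p ν κ)]
  -- Only the last block of columns involves `A₀`, so the matrix factors through `diag(1, A₀)`.
  have hprod : (fromBlocks N (fromCols (-Y₂) (-Y₁ * A₀)) T (fromCols X₂ (X₁ * A₀))).submatrix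
      (Equiv.sumAssoc p ν κ) (Equiv.sumAssoc p ν κ) =
      (fromCols (fromCols (fromRows N T) (fromRows (-Y₂) X₂)) (fromRows (-Y₁) X₁)).submatrix
        (Equiv.sumAssoc p ν κ) id * (fromBlocks 1 0 0 A₀ :
          Matrix ((p ⊕ ν) ⊕ ι) ((p ⊕ ν) ⊕ κ) Λ) := by
    ext ((r | r) | r) ((c | c) | c) <;> simp [mul_apply, one_apply]
  rw [hprod]
  exact dvd_det_mul_of_forall_dvd _ _ (dvd_det_submatrix_fromBlocks_one A₀ ha)

end Matrix

/-! ## Twisted Alexander polynomials of quotients -/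

instance LaurentPolynomial.uniqueFactorizationMonoid {R : Type u} [CommRing R] [IsDomain R]
    [UniqueFactorizationMonoid R] : UniqueFactorizationMonoid (LaurentPolynomial R) :=
  UniqueFactorizationMonoid.of_isLocalization
    (Submonoid.powers (Polynomial.X : Polynomial R)) (LaurentPolynomial R)

/-- After division by `gcd a c`, the quotient of `a` divides every `f i`, hence `d`. -/
theorem IsGcdOfFamily.dvd_mul {A ι : Type*} [CommRing A] [IsDomain A]
    [UniqueFactorizationMonoid A] {f : ι → A} {d : A} (hd : IsGcdOfFamily f d) {a c : A}
    (h : ∀ i, a ∣ f i * c) : a ∣ d * c := by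
  classical
  let _ : GCDMonoid A := UniqueFactorizationMonoid.toGCDMonoid A
  obtain ⟨a', ha'⟩ := gcd_dvd_left a c
  obtain ⟨c', hc'⟩ := gcd_dvd_right a c
  by_cases h0 : gcd a c = 0
  · rw [h0, zero_mul] at hc'
    simp [hc']
  have h1 : a' ∣ d := (hd a').2 fun i => by
    have h2 : a ∣ gcd (f i * a) (f i * c) := dvd_gcd (Dvd.intro_left _ rfl) (h i)
    have h3 := h2.trans (gcd_mul_left' (f i) a c).dvd
    rw [mul_comm (f i)] at h3
    nth_rewrite 1 [ha'] at h3
    exact (mul_dvd_mul_iff_left h0).1 h3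
  rw [ha', mul_comm d]
  exact mul_dvd_mul (gcd_dvd_right a c) h1

namespace Matrix

variable {Λ : Type*} [CommRing Λ] {ν : Type*} [Fintype ν]

theorem comp_mul {I J L : Type*} [Fintype J] (A : Matrix I J (Matrix ν ν Λ))
    (B : Matrix J L (Matrix ν ν Λ)) :
    comp I L ν ν Λ (A * B) = comp I J ν ν Λ A * comp J L ν ν Λ B := by
  ext ⟨i, a⟩ ⟨l, b⟩
  simp [mul_apply, sum_apply, Fintype.sum_prod_type]

/-- The column of blocks `D`, as a matrix. -/
def stack {J : Type*} (D : J → Matrix ν ν Λ) : Matrix (J × ν) ν Λ :=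
  of fun x b => D x.1 x.2 b

theorem comp_mul_stack {I J : Type*} [Fintype J] (A : Matrix I J (Matrix ν ν Λ))
    (D : J → Matrix ν ν Λ) :
    comp I J ν ν Λ A * stack D = stack fun i => ∑ l, A i l * D l := by
  ext ⟨i, a⟩ b
  simp [stack, mul_apply, sum_apply, Fintype.sum_prod_type]

theorem submatrix_mul_add {I J L p q I' L' : Type*} [Fintype J] [Fintype p] [Fintype q]
    (A : Matrix I J Λ) (B : Matrix J L Λ) (e : p ⊕ q ≃ J) (r : I' → I) (c : L' → L) :
    A.submatrix r (fun x => e (Sum.inr x)) * B.submatrix (fun x => e (Sum.inr x)) c +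
      A.submatrix r (fun x => e (Sum.inl x)) * B.submatrix (fun x => e (Sum.inl x)) c =
      (A * B).submatrix r c := by
  ext i l
  simp only [Matrix.add_apply, mul_apply, submatrix_apply]
  rw [← e.sum_comp, Fintype.sum_sum_type, add_comm]

end Matrix

/-- The splitting of the index set of the columns into those of `j` and the others. -/
def splitColumns {s : ℕ} (j : Fin s) (n : ℕ) :
    Fin n ⊕ ({k : Fin s // k ≠ j} × Fin n) ≃ Fin s × Fin n where
  toFun := Sum.elim (fun a => (j, a)) (fun x => (x.1.1, x.2))
  invFun x := if h : x.1 = j then Sum.inl x.2 else Sum.inr (⟨x.1, h⟩, x.2)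
  left_inv := by
    rintro (a | ⟨⟨k, hk⟩, a⟩)
    · simp
    · simp [hk]
  right_inv := by
    rintro ⟨k, a⟩
    by_cases h : k = j
    · simp [h]
    · simp [h]

section Quotient

open Matrix

variable {G G' : Type} [Group G] [Group G'] {R : Type u} [CommRing R] {n : ℕ}
  {α : G →* Multiplicative ℤ} {β : G' →* Multiplicative ℤ}
  {φ : G →* G'} {ρ' : G' →* Matrix.GeneralLinearGroup (Fin n) R}

/-- Let `θ` lift `φ` to the free groups, with Fox Jacobian `Wf`. Relators go to consequences of
relators (`hFW`), and surjectivity provides a right inverse up to relators (`hUW`). So the Alexander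
module of `G` maps onto that of `G'`, and `Matrix.mul_det_dvd_det_mul` compares the minors. -/
theorem mul_twistedDenominator_dvd (hφ : Function.Surjective φ) (hα : ∀ g, β (φ g) = α g)
    (P : FiniteGroupPresentation G) (j : Fin P.s) (P' : FiniteGroupPresentation G')
    (j' : Fin P'.s) {a : LaurentPolynomial R}
    (ha : ∀ f : ({k : Fin P'.s // k ≠ j'} × Fin n) → (Fin P'.m × Fin n),
      a ∣ ((twistedAlexanderMatrix β ρ' P' j').submatrix f id).det)
    (f : ({k : Fin P.s // k ≠ j} × Fin n) → (Fin P.m × Fin n)) :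
    a * twistedDenominator α (ρ'.comp φ) P j ∣
      ((twistedAlexanderMatrix α (ρ'.comp φ) P j).submatrix f id).det *
        twistedDenominator β ρ' P' j' := by
  classical
  let Φ := (twistedWeight α (ρ'.comp φ)).comp P.proj
  let Φ' := (twistedWeight β ρ').comp P'.proj
  choose W hW using fun k => P'.proj_surjective (φ (P.proj (FreeGroup.of k)))
  choose U hU using fun l => (hφ.comp P.proj_surjective) (P'.proj (FreeGroup.of l))
  let θ : FreeGroup (Fin P.s) →* FreeGroup (Fin P'.s) := FreeGroup.lift W
  have hθ : ∀ w, P'.proj (θ w) = φ (P.proj w) := by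
    have : P'.proj.comp θ = φ.comp P.proj := FreeGroup.ext_hom _ _ fun k => by simp [θ, hW]
    exact DFunLike.congr_fun this
  have hΦ : ∀ w, Φ' (θ w) = Φ w := fun w => by
    simp [Φ, Φ', hθ, twistedWeight, hα]
  have hrel' : ∀ i, Φ' (P'.rel i) = 1 := fun i => by
    rw [MonoidHom.comp_apply, P'.proj_rel, map_one]
  have hchain : ∀ w l, foxEval Φ' l (θ w) = ∑ k, foxEval Φ k w * foxEval Φ' l (W k) := by
    intro w l
    have := derivation_eq_sum Φ (fun w => foxEval Φ' l (θ w)) (fun v w => by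
      rw [map_mul, foxEval_mul, hΦ, smul_eq_mul]) w
    simpa [θ] using this
  have hC : ∀ i, ∃ c : Fin P'.m → Matrix (Fin n) (Fin n) (LaurentPolynomial R),
      ∀ l, foxEval Φ' l (θ (P.rel i)) = ∑ i', c i' * foxEval Φ' l (P'.rel i') := fun i =>
    exists_foxEval_eq_sum P'.rel Φ' hrel' (P'.mem_normalClosure (by
      rw [hθ, P.proj_rel, map_one]))
  have hE : ∀ l₀, ∃ c : Fin P'.m → Matrix (Fin n) (Fin n) (LaurentPolynomial R),
      ∀ l, foxEval Φ' l (θ (U l₀)) =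
        (if l₀ = l then 1 else 0) + ∑ i', c i' * foxEval Φ' l (P'.rel i') := fun l₀ => by
    have h1 : P'.proj (θ (U l₀) * (FreeGroup.of l₀)⁻¹) = 1 := by
      rw [map_mul, map_inv, hθ, mul_inv_eq_one]
      exact hU l₀
    obtain ⟨c, hc⟩ := exists_foxEval_eq_sum P'.rel Φ' hrel' (P'.mem_normalClosure h1)
    refine ⟨c, fun l => ?_⟩
    have h2 := foxEval_mul Φ' l (θ (U l₀) * (FreeGroup.of l₀)⁻¹) (FreeGroup.of l₀)
    rw [inv_mul_cancel_right, hc, MonoidHom.comp_apply, h1, map_one, one_mul, foxEval_of,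
      add_comm] at h2
    exact h2
  choose C hC using hC
  choose E hE using hE
  -- Fox's fundamental formula, from the derivation `w ↦ Φ' w - 1`.
  have hfund : ∀ w, ∑ l, foxEval Φ' l w * (Φ' (FreeGroup.of l) - 1) = Φ' w - 1 := fun w =>
    (derivation_eq_sum Φ' (fun w => Φ' w - 1) (fun v w => by
      rw [map_mul, smul_eq_mul, mul_sub, mul_one]; abel) w).symm
  let Ff := comp _ _ _ _ _ (of fun (i : Fin P.m) (k : Fin P.s) => foxEval Φ k (P.rel i))
  let Ff' := comp _ _ _ _ _ (of fun (i : Fin P'.m) (l : Fin P'.s) => foxEval Φ' l (P'.rel i))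
  let Wf := comp _ _ _ _ _ (of fun (k : Fin P.s) (l : Fin P'.s) => foxEval Φ' l (W k))
  let Uf := comp _ _ _ _ _ (of fun (l : Fin P'.s) (k : Fin P.s) => foxEval Φ k (U l))
  let Cf := comp _ _ _ _ _ (of C)
  let Ef := comp _ _ _ _ _ (of E)
  let D : Matrix (Fin P'.s × Fin n) (Fin n) (LaurentPolynomial R) :=
    stack fun l => Φ' (FreeGroup.of l) - 1
  have hFW : Ff * Wf = Cf * Ff' := by
    rw [← comp_mul, ← comp_mul]
    congr 1
    ext1 i l
    rw [mul_apply, mul_apply]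
    simp only [of_apply]
    rw [← hchain, hC]
  have hUW : Uf * Wf = 1 + Ef * Ff' := by
    have h1 : (1 : Matrix (Fin P'.s × Fin n) (Fin P'.s × Fin n) (LaurentPolynomial R)) =
        comp _ _ _ _ _ (1 : Matrix (Fin P'.s) (Fin P'.s) (Matrix (Fin n) (Fin n) _)) :=
      (map_one (compRingEquiv (Fin P'.s) (Fin n) (LaurentPolynomial R))).symm
    have h2 : ∀ A B : Matrix (Fin P'.s) (Fin P'.s)
        (Matrix (Fin n) (Fin n) (LaurentPolynomial R)),
        comp _ _ _ _ _ A + comp _ _ _ _ _ B = comp _ _ _ _ _ (A + B) := fun _ _ => rfl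
    rw [← comp_mul, ← comp_mul, h1, h2]
    congr 1
    ext1 l₀ l
    rw [Matrix.add_apply, mul_apply, mul_apply]
    simp only [of_apply]
    rw [← hchain, hE, one_apply]
  have hFD : Ff' * D = 0 := by
    rw [comp_mul_stack]
    simp only [of_apply, hfund, hrel', sub_self]
    rfl
  have hWD : Wf * D = stack fun k => Φ (FreeGroup.of k) - 1 := by
    rw [comp_mul_stack]
    simp only [of_apply, hfund]
    congr 1
    ext1 k
    rw [← hΦ]
    simp [θ]
  let e := splitColumns j n
  let e' := splitColumns j' n
  -- Deleting the columns of `j` means killing the generator `j`; its image, the block row `j` of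
  -- `Wf`, becomes the additional relation `w` on the side of `G'`.
  have main := mul_det_dvd_det_mul (N := Ff.submatrix f fun x => e (Sum.inr x))
    (V := Wf.submatrix (fun x => e (Sum.inr x)) e')
    (T := Uf.submatrix e' fun x => e (Sum.inr x))
    (A := Ff'.submatrix id e') (w := Wf.submatrix (fun x => e (Sum.inl x)) e')
    (X₁ := -Ef.submatrix e' id) (X₂ := Uf.submatrix e' fun x => e (Sum.inl x))
    (Y₁ := Cf.submatrix f id) (Y₂ := -Ff.submatrix f fun x => e (Sum.inl x))
    (D := D.submatrix e' id) (a := a) ?_ ?_ ?_ ?_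
  · have h1 : (Wf.submatrix (fun x => e (Sum.inl x)) e' * D.submatrix e' id) =
        Φ (FreeGroup.of j) - 1 := by
      rw [submatrix_mul_equiv, hWD]
      rfl
    rw [h1] at main
    have h2 : twistedDenominator α (ρ'.comp φ) P j = (Φ (FreeGroup.of j) - 1).det := by
      simp [twistedDenominator, twistedEval, Φ]
    have h3 : twistedDenominator β ρ' P' j' = (Φ' (FreeGroup.of j') - 1).det := by
      simp [twistedDenominator, twistedEval, Φ']
    rw [h2, h3]
    exact main
  · have h1 := submatrix_mul_add Uf Wf e e' e'
    have h2 : (1 + Ef * Ff').submatrix e' e' = 1 + Ef.submatrix e' id * Ff'.submatrix id e' :=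
      congrArg (· + Ef.submatrix e' id * Ff'.submatrix id e') (submatrix_one_equiv e')
    rw [hUW, h2] at h1
    rw [add_right_comm, h1, Matrix.neg_mul]
    exact add_neg_cancel_right _ _
  · have h1 := submatrix_mul_add Ff Wf e f e'
    rw [hFW] at h1
    rw [Matrix.neg_mul, ← sub_eq_add_neg, eq_sub_iff_add_eq, h1]
    rfl
  · rw [submatrix_mul_equiv, hFD]
    rfl
  · exact ha

theorem twistedDvd_of_surjective [IsDomain R] [UniqueFactorizationMonoid R]
    (hφ : Function.Surjective φ) (hα : ∀ g, β (φ g) = α g)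
    {Δ Δ' : FractionRing (LaurentPolynomial R)}
    (h : IsTwistedAlexanderPolynomial α (ρ'.comp φ) Δ)
    (h' : IsTwistedAlexanderPolynomial β ρ' Δ') : TwistedDvd Δ' Δ := by
  obtain ⟨P, j, Q, hden, hQ, hΔ⟩ := h
  obtain ⟨P', j', Q', hden', hQ', hΔ'⟩ := h'
  obtain ⟨q, hq⟩ := hQ.dvd_mul fun f =>
    mul_twistedDenominator_dvd hφ hα P j P' j' ((hQ' Q').1 dvd_rfl) f
  refine ⟨q, ?_⟩
  set d := twistedDenominator α (ρ'.comp φ) P j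
  set d' := twistedDenominator β ρ' P' j'
  have hinj := IsFractionRing.injective (LaurentPolynomial R)
    (FractionRing (LaurentPolynomial R))
  have hd0 : algebraMap _ (FractionRing (LaurentPolynomial R)) d ≠ 0 := by
    rwa [ne_eq, map_eq_zero_iff _ hinj]
  have hd0' : algebraMap _ (FractionRing (LaurentPolynomial R)) d' ≠ 0 := by
    rwa [ne_eq, map_eq_zero_iff _ hinj]
  have hq' := congrArg (algebraMap _ (FractionRing (LaurentPolynomial R))) hq
  rw [map_mul, map_mul, map_mul, ← hΔ, ← hΔ'] at hq'
  apply mul_right_cancel₀ hd0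
  apply mul_right_cancel₀ hd0'
  rw [hq']
  ring

end Quotient

/-! ## The Alexander polynomial -/

/-- The sixth cyclotomic polynomial is the minimal polynomial of `ω` over `ℤ`; a power of `t` clears
the denominators of `f`. -/
theorem LaurentPolynomial.dvd_of_eval_eq_zero {ω : ℂˣ} (hω : IsPrimitiveRoot (ω : ℂ) 6)
    {f : LaurentPolynomial ℤ} (hf : LaurentPolynomial.eval₂ (Int.castRingHom ℂ) ω f = 0) :
    (1 - LaurentPolynomial.T 1 + LaurentPolynomial.T 2 : LaurentPolynomial ℤ) ∣ f := by
  obtain ⟨n, p, hp⟩ := LaurentPolynomial.exists_T_pow f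
  have h1 : Polynomial.aeval (ω : ℂ) p = 0 := by
    have := LaurentPolynomial.eval₂_toLaurent (Int.castRingHom ℂ) ω p
    rw [hp, map_mul, hf, zero_mul] at this
    exact this.symm
  have h2 : minpoly ℤ (ω : ℂ) ∣ p :=
    minpoly.isIntegrallyClosed_dvd (hω.isIntegral (by norm_num)) h1
  rw [← Polynomial.cyclotomic_eq_minpoly hω (by norm_num), Polynomial.cyclotomic_six] at h2
  have h3 := map_dvd Polynomial.toLaurent h2
  rw [hp] at h3
  have h4 : (1 - LaurentPolynomial.T 1 + LaurentPolynomial.T 2 : LaurentPolynomial ℤ) =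
      Polynomial.toLaurent (Polynomial.X ^ 2 - Polynomial.X + 1) := by
    simp only [map_add, map_sub, Polynomial.toLaurent_X_pow, Polynomial.toLaurent_X, map_one]
    push_cast
    ring
  rw [h4]
  have h5 : f = f * LaurentPolynomial.T n * LaurentPolynomial.T (-n) := by
    rw [mul_assoc, ← LaurentPolynomial.T_add]; simp
  rw [h5]
  exact Dvd.dvd.mul_right h3 _

theorem RingHom.comp_foxEval {X : Type} [DecidableEq X] {S T : Type*} [Ring S] [Ring T]
    (f : S →+* T) (Φ : FreeGroup X →* S) (j : X) (w : FreeGroup X) :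
    f (foxEval Φ j w) = foxEval ((f : S →* T).comp Φ) j w := by
  have : f.toIntAlgHom.comp (MonoidAlgebra.lift ℤ S (FreeGroup X) Φ) =
      MonoidAlgebra.lift ℤ T (FreeGroup X) ((f : S →* T).comp Φ) := by
    refine (MonoidAlgebra.lift ℤ T (FreeGroup X)).symm.injective (MonoidHom.ext fun g => ?_)
    simp [MonoidAlgebra.lift_symm_apply]
  exact DFunLike.congr_fun this _

/-- If all derivations of a two-dimensional family vanish on the relators, then the Alexander
matrix has corank at least two. -/
theorem det_submatrix_foxEval_eq_zero {k : Type*} [Field k] {s m : ℕ}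
    (rel : Fin m → FreeGroup (Fin s)) (Ψ : FreeGroup (Fin s) →* k) (D₁ D₂ : FreeGroup (Fin s) → k)
    (h₁ : ∀ v w, D₁ (v * w) = D₁ v + Ψ v * D₁ w) (h₂ : ∀ v w, D₂ (v * w) = D₂ v + Ψ v * D₂ w)
    (hr₁ : ∀ i, D₁ (rel i) = 0) (hr₂ : ∀ i, D₂ (rel i) = 0)
    (hind : ∀ c₁ c₂ : k, (∀ w, c₁ * D₁ w + c₂ * D₂ w = 0) → c₁ = 0 ∧ c₂ = 0)
    (f : Fin (s - 1) → Fin m) (g : Fin (s - 1) → Fin s) :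
    ((Matrix.of fun i j => foxEval Ψ j (rel i)).submatrix f g).det = 0 := by
  classical
  by_contra hdet
  have hg : Function.Injective g := by
    intro a b hab
    by_contra hne
    exact hdet (Matrix.det_zero_of_column_eq hne fun i => by simp [hab])
  have hD : ∀ c₁ c₂ w, c₁ * D₁ w + c₂ * D₂ w =
      ∑ j, foxEval Ψ j w * (c₁ * D₁ (FreeGroup.of j) + c₂ * D₂ (FreeGroup.of j)) :=
    fun c₁ c₂ w => derivation_eq_sum Ψ (fun w => c₁ * D₁ w + c₂ * D₂ w) (fun v w => by
      rw [h₁, h₂, smul_eq_mul]; ring) w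
  have key : ∃ c₁ c₂ : k, ¬ (c₁ = 0 ∧ c₂ = 0) ∧
      ∀ j, c₁ * D₁ (FreeGroup.of j) + c₂ * D₂ (FreeGroup.of j) = 0 := by
    -- Here `s - 1` is also `0` and the minor is the empty determinant `1`, but the condition on the
    -- generators is vacuous.
    by_cases hs : s = 0
    · subst hs
      exact ⟨1, 0, by simp, fun j => j.elim0⟩
    obtain ⟨j₀, hj₀⟩ : ∃ j₀, ∀ i, g i ≠ j₀ := by
      by_contra hcon
      push Not at hcon
      have := Fintype.card_le_of_surjective g hcon
      simp at this
      omega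
    have himg : Finset.univ.image g = Finset.univ.erase j₀ := by
      refine Finset.eq_of_subset_of_card_le (fun x hx => ?_) ?_
      · obtain ⟨i, -, rfl⟩ := Finset.mem_image.1 hx
        simp [hj₀ i]
      · rw [Finset.card_image_of_injective _ hg, Finset.card_erase_of_mem (Finset.mem_univ _)]
        simp
    -- A combination that vanishes on the omitted generator `j₀` lies in the kernel of the chosen
    -- minor, hence vanishes on all generators.
    obtain ⟨c₁, c₂, hc, h0⟩ : ∃ c₁ c₂ : k, ¬ (c₁ = 0 ∧ c₂ = 0) ∧
        c₁ * D₁ (FreeGroup.of j₀) + c₂ * D₂ (FreeGroup.of j₀) = 0 := by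
      by_cases h : D₁ (FreeGroup.of j₀) = 0
      · exact ⟨1, 0, by simp, by simp [h]⟩
      · exact ⟨D₂ (FreeGroup.of j₀), -D₁ (FreeGroup.of j₀), by simp [h], by ring⟩
    refine ⟨c₁, c₂, hc, ?_⟩
    have hv := Matrix.eq_zero_of_mulVec_eq_zero hdet
      (v := fun i => c₁ * D₁ (FreeGroup.of (g i)) + c₂ * D₂ (FreeGroup.of (g i))) (by
        ext i
        have h := hD c₁ c₂ (rel (f i))
        rw [hr₁, hr₂, mul_zero, mul_zero, add_zero,
          ← Finset.add_sum_erase _ _ (Finset.mem_univ j₀), h0, mul_zero, zero_add, ← himg,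
          Finset.sum_image hg.injOn] at h
        exact h.symm)
    intro j
    by_cases hj : j = j₀
    · rw [hj, h0]
    · have : j ∈ Finset.univ.image g := by rw [himg]; simp [hj]
      obtain ⟨i, -, rfl⟩ := Finset.mem_image.1 this
      exact congrFun hv i
  obtain ⟨c₁, c₂, hc, hv⟩ := key
  refine hc (hind c₁ c₂ fun w => ?_)
  rw [hD]
  simp [hv]

namespace BraidThree

/-- The similarity `z ↦ ω z + b` of the plane. -/
def similarity (ω : ℂˣ) (b : ℂ) : Equiv.Perm ℂ where
  toFun z := ω * z + b
  invFun z := (ω⁻¹ : ℂˣ) * (z - b)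
  left_inv z := by simp
  right_inv z := by simp

/-- The action of `B₃` on the plane by rotations, the Burau representation at a root of
`1 - t + t²`. -/
def rotation (ω : ℂˣ) (hω : (1 - ω + ω ^ 2 : ℂ) = 0) : BraidThree →* Equiv.Perm ℂ :=
  ofSigma (similarity ω 0) (similarity ω 1) (by
    ext1 z
    simp only [Equiv.Perm.mul_apply, similarity, Equiv.coe_fn_mk]
    linear_combination (-1 : ℂ) * hω)

/-- The linear part is `ω ^ ε(g)`, so the translation part, the image of `0`, is a derivation with
respect to `g ↦ ω ^ ε(g)`. -/
theorem rotation_apply {ω : ℂˣ} (hω : (1 - ω + ω ^ 2 : ℂ) = 0) (g : BraidThree) (z : ℂ) :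
    rotation ω hω g z =
      ((ω ^ (Multiplicative.toAdd (exponentSum g)) : ℂˣ) : ℂ) * z + rotation ω hω g 0 := by
  let S : Subgroup BraidThree :=
    { carrier := {g | ∀ z, rotation ω hω g z =
        ((ω ^ (Multiplicative.toAdd (exponentSum g)) : ℂˣ) : ℂ) * z + rotation ω hω g 0}
      one_mem' := fun z => by simp
      mul_mem' := by
        intro g k hg hk z
        rw [map_mul, map_mul, Equiv.Perm.mul_apply, Equiv.Perm.mul_apply, hk z, hg,
          hg (rotation ω hω k 0), toAdd_mul, zpow_add, Units.val_mul]
        ring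
      inv_mem' := by
        intro g hg z
        have e : ∀ z, rotation ω hω g (rotation ω hω g⁻¹ z) = z := fun z => by
          rw [← Equiv.Perm.mul_apply, ← map_mul, mul_inv_cancel, map_one, Equiv.Perm.one_apply]
        have h1 := hg (rotation ω hω g⁻¹ z)
        have h2 := hg (rotation ω hω g⁻¹ 0)
        rw [e] at h1 h2
        have h3 : z = ((ω ^ (Multiplicative.toAdd (exponentSum g)) : ℂˣ) : ℂ) *
            (rotation ω hω g⁻¹ z - rotation ω hω g⁻¹ 0) := by
          linear_combination h1 - h2
        rw [← sub_eq_iff_eq_add, map_inv exponentSum, toAdd_inv, zpow_neg]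
        exact (Units.inv_mul_eq_iff_eq_mul _).2 h3 |>.symm }
  have : S = ⊤ := eq_top_of_sigma_mem
    (fun z => by simp [rotation, similarity]) (fun z => by simp [rotation, similarity])
  have hg : g ∈ S := by rw [this]; trivial
  exact hg z

end BraidThree

theorem IsAlexanderPolynomial.dvd_of_surjective {G : Type} [Group G] {α : G →* Multiplicative ℤ}
    {φ : G →* BraidThree} (hφ : Function.Surjective φ)
    (hα : ∀ g, BraidThree.exponentSum (φ g) = α g) {Δ : LaurentPolynomial ℤ}
    (hΔ : IsAlexanderPolynomial α Δ) :
    (1 - LaurentPolynomial.T 1 + LaurentPolynomial.T 2 : LaurentPolynomial ℤ) ∣ Δ := by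
  obtain ⟨P, hP⟩ := hΔ
  refine (hP _).2 fun f => ?_
  have hprim := Complex.isPrimitiveRoot_exp 6 (by norm_num)
  obtain ⟨ω, hω⟩ := hprim.isUnit (by norm_num)
  rw [← hω] at hprim
  have hroot : (1 - ω + ω ^ 2 : ℂ) = 0 := by
    have h := hprim.isRoot_cyclotomic (by norm_num)
    rw [Polynomial.cyclotomic_six] at h
    have h' : (ω ^ 2 - ω + 1 : ℂ) = 0 := by simpa using h
    linear_combination h'
  refine LaurentPolynomial.dvd_of_eval_eq_zero hprim ?_
  let ev := LaurentPolynomial.eval₂ (Int.castRingHom ℂ) ω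
  let Φ := (abelianWeight α).comp P.proj
  let Ψ := (ev : LaurentPolynomial ℤ →* ℂ).comp Φ
  have hΨ : ∀ w, Ψ w = ((ω ^ (Multiplicative.toAdd (α (P.proj w))) : ℂˣ) : ℂ) := fun w => by
    simp [Ψ, Φ, ev, abelianWeight]
  change ev _ = 0
  rw [RingHom.map_det]
  have hmat : ev.mapMatrix ((alexanderMatrix α P).submatrix f.1 f.2) =
      (Matrix.of fun i j => foxEval Ψ j (P.rel i)).submatrix f.1 f.2 := by
    ext i j
    exact RingHom.comp_foxEval ev Φ (f.2 j) (P.rel (f.1 i))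
  rw [hmat]
  -- The principal derivation and the translation part both factor through `G`, so they vanish on
  -- relators. They are independent: on `σ₁` they take the values `ω - 1 ≠ 0` and `0`, and on `σ₂`
  -- the second one is `1`.
  refine det_submatrix_foxEval_eq_zero P.rel Ψ (fun w => Ψ w - 1)
    (fun w => BraidThree.rotation ω hroot (φ (P.proj w)) 0) (fun v w => ?_) (fun v w => ?_)
    (fun i => ?_) (fun i => ?_) (fun c₁ c₂ h => ?_) f.1 f.2
  · rw [map_mul]; ring
  · rw [map_mul, map_mul, map_mul, Equiv.Perm.mul_apply, BraidThree.rotation_apply, hΨ, hα]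
    ring
  · rw [hΨ, P.proj_rel]; simp
  · rw [P.proj_rel]; simp
  · have hω1 : (ω : ℂ) - 1 ≠ 0 := by
      intro h1
      rw [sub_eq_zero.1 h1] at hroot
      norm_num at hroot
    obtain ⟨w₀, hw₀⟩ := (hφ.comp P.proj_surjective) (BraidThree.sigma 0)
    obtain ⟨w₁, hw₁⟩ := (hφ.comp P.proj_surjective) (BraidThree.sigma 1)
    simp only [Function.comp_apply] at hw₀ hw₁
    have e₀ := h w₀
    have e₁ := h w₁
    rw [hΨ, ← hα, hw₀] at e₀
    rw [hΨ, ← hα, hw₁] at e₁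
    simp [BraidThree.rotation, BraidThree.similarity] at e₀ e₁
    rcases e₀ with h0 | h0
    · subst h0
      exact ⟨rfl, by simpa using e₁⟩
    · exact absurd h0 hω1

theorem mainTheorem6 (K : Set ThreeSphere) (hK : IsTameKnot K) (x₀ : ↥(Kᶜ))
    (hcol : IsTricolorable K x₀)
    (α : KnotGroup K x₀ →* Multiplicative ℤ) (hα : IsInfiniteCyclicAbelianization α) :
    ((∃ Δ : LaurentPolynomial ℤ, IsAlexanderPolynomial α Δ ∧
        ¬ (1 - LaurentPolynomial.T 1 + LaurentPolynomial.T 2 : LaurentPolynomial ℤ) ∣ Δ) →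
      ∀ c : KnotGroup K x₀ →* Equiv.Perm (Fin 3),
        IsNontrivialTricoloring K x₀ c → ¬ LiftsToSimpleBraidColoring K x₀ c) ∧
    (∀ (R : Type u) [CommRing R] [IsDomain R] [UniqueFactorizationMonoid R] (n : ℕ)
        (ρ' : BraidThree →* Matrix.GeneralLinearGroup (Fin n) R)
        (Δ' : FractionRing (LaurentPolynomial R)),
      IsTwistedAlexanderPolynomial BraidThree.exponentSum ρ' Δ' →
      (∀ ρ : KnotGroup K x₀ →* Matrix.GeneralLinearGroup (Fin n) R, ρ.range = ρ'.range →
        ∃ Δ : FractionRing (LaurentPolynomial R),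
          IsTwistedAlexanderPolynomial α ρ Δ ∧ ¬ TwistedDvd Δ' Δ) →
      ∀ c : KnotGroup K x₀ →* Equiv.Perm (Fin 3),
        IsNontrivialTricoloring K x₀ c → ¬ LiftsToSimpleBraidColoring K x₀ c) := by
  constructor
  · rintro ⟨Δ, hΔ, hndvd⟩ c hc hl
    obtain ⟨φ, hφ, hφα⟩ := exists_surjective_of_lifts hα hc hl
    exact hndvd (hΔ.dvd_of_surjective hφ hφα)
  · intro R _ _ _ n ρ' Δ' hΔ' h c hc hl
    obtain ⟨φ, hφ, hφα⟩ := exists_surjective_of_lifts hα hc hl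
    -- As `φ` is onto, `ρ' ∘ φ` has the same image as `ρ'`.
    obtain ⟨Δ, hΔ, hndvd⟩ := h (ρ'.comp φ) (by
      rw [MonoidHom.range_comp, MonoidHom.range_eq_top.2 hφ, ← MonoidHom.range_eq_map])
    exact hndvd (twistedDvd_of_surjective hφ hφα hΔ hΔ')
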